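/- An abelian variety over $\mathbb{R}$ is a proper, smooth, geometrically integral group scheme $A$ over $\mathbb{R}$. Let $\sigma \colon A(\mathbb{C}) \to A(\mathbb{C})$ be complex conjugation, let $V_A \to A(\mathbb{C})$ be the universal covering of the complex torus $A(\mathbb{C})$, a surjective holomorphic homomorphism from a finite-dimensional complex vector space whose kernel $\Lambda_A = \mathrm{H}_1(A(\mathbb{C}),\mathbb{Z})$ is a lattice in $V_A = \Lambda_A \otimes \mathbb{R}$, and let $F_\infty \colon V_A \to V_A$ be the lift of $\sigma$, i.e. the map induced by $\sigma$ on $\Lambda_A\otimes\mathbb{R}$. A polarization $\lambda_A$ on $A$ is an alternating form $E_A \colon \Lambda_A \times \Lambda_A \to \mathbb{Z}$ such that $E_A(F_\infty x, F_\infty y) = -E_A(x,y)$ for all $x, y$, and such that $H(x,y) = E_A(ix,y) + iE_A(x,y)$ (with $E_A$ extended $\mathbb{R}$-bilinearly to $V_A$) is a positive definite hermitian form on $V_A$. It is principal if $E_A$ is unimodular, i.e. if $\Lambda_A \to \mathrm{Hom}(\Lambda_A,\mathbb{Z})$, $x \mapsto E_A(x,\cdot)$, is bijective. An isogeny is a finite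 surjective homomorphism of group schemes over $\mathbb{R}$. **Theorem 4.1.** Let $(A,\lambda_A)$ be a polarized abelian variety over $\mathbb{R}$. Then there exist a principally polarized abelian variety $(B,\lambda_B)$ over $\mathbb{R}$ and an isogeny $\phi \colon A \to B$ over $\mathbb{R}$ such that $\phi^*(\lambda_B) = \lambda_A$, that is, $E_B(\phi_* x, \phi_* y) = E_A(x,y)$ for all $x, y \in \Lambda_A$, where $\phi_* \colon \Lambda_A \to \Lambda_B$ is the map induced by $\phi$. -/

import Mathlib

open CategoryTheory AlgebraicGeometry
open scoped MonObj

noncomputable section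

/-- An abelian variety over `ℝ`: a proper, smooth, geometrically integral group scheme over `ℝ`
(it is then automatically commutative). -/
structure RealAbelianVariety where
  /-- the underlying scheme over `ℝ` -/
  X : Over (Spec (.of ℝ))
  [grpObj : GrpObj X]
  [isProper : IsProper X.hom]
  [smooth : Smooth X.hom]
  [geometricallyIntegral : GeometricallyIntegral X.hom]

attribute [instance] RealAbelianVariety.grpObj RealAbelianVariety.isProper
  RealAbelianVariety.smooth RealAbelianVariety.geometricallyIntegral

/-- `Spec ℂ` as a scheme over `ℝ`. -/
abbrev specComplex : Over (Spec (.of ℝ)) :=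
  Over.mk (Spec.map (CommRingCat.ofHom (algebraMap ℝ ℂ)))

/-- Complex conjugation on `Spec ℂ`, as a morphism over `ℝ`. -/
abbrev specConj : specComplex ⟶ specComplex :=
  Over.homMk (Spec.map (CommRingCat.ofHom (starRingEnd ℂ))) (by
    simp only [specComplex, Over.mk_hom, ← Spec.map_comp, ← CommRingCat.ofHom_comp]
    congr 2
    ext r
    exact Complex.conj_ofReal r)

namespace RealAbelianVariety

/-- The set `A(ℂ)` of complex points of `A`, i.e. of morphisms `Spec ℂ ⟶ A` over `ℝ`. It is a group
(`CategoryTheory.Hom.group`) under the group law given by the group scheme structure of `A`. -/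
abbrev ComplexPoint (A : RealAbelianVariety) : Type := specComplex ⟶ A.X

variable {A B : RealAbelianVariety}

/-- The canonical real structure `σ : A(ℂ) → A(ℂ)`, given by complex conjugation. -/
def ComplexPoint.conj (p : A.ComplexPoint) : A.ComplexPoint := specConj ≫ p

/-- The image of a complex point under a morphism over `ℝ`. -/
def ComplexPoint.map (φ : A.X ⟶ B.X) (p : A.ComplexPoint) : B.ComplexPoint :=
  p ≫ φ

/-- The complex point `p` lies in the Zariski open subset `U`. -/
def ComplexPoint.MemOpen (p : A.ComplexPoint) (U : A.X.left.Opens) : Prop :=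
  ⊤ ≤ p.left ⁻¹ᵁ U

open Classical in
/-- The value `f(p) ∈ ℂ` of a regular function `f` on `U` at a complex point `p` of `U`
(and `0` if `p` is not a point of `U`). -/
def ComplexPoint.eval (p : A.ComplexPoint) {U : A.X.left.Opens} (f : Γ(A.X.left, U)) : ℂ :=
  if h : p.MemOpen U then
    (Scheme.ΓSpecIso (.of ℂ)).hom.hom ((p.left.appLE U ⊤ h).hom f)
  else 0

/-- The presentation of the complex Lie group `A(ℂ)` as a complex torus `V / Λ`, i.e. its universal
covering `exp : V → A(ℂ)`, where `V` is a finite-dimensional complex vector space: a surjective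
holomorphic homomorphism whose kernel `Λ` is a lattice in `V`. (The induced bijective holomorphic
homomorphism `V / Λ → A(ℂ)` is then automatically biholomorphic, and `Λ = H₁(A(ℂ), ℤ)`.)
Such a covering is unique up to a unique complex linear isomorphism.

Holomorphy of `exp` is expressed by regular functions: it pulls back every Zariski open subset `U`
of `A` to an open subset of `V`, and every regular function on `U` to a holomorphic function.

The lift `frob` of `σ` to `V` is the map induced by `σ` on `H₁(A(ℂ), ℤ) ⊗ ℝ = V`; it is determined
by `exp`. -/
structure Uniformization (A : RealAbelianVariety) where
  /-- the complex vector space `V` -/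
  V : Type
  [normedAddCommGroup : NormedAddCommGroup V]
  [normedSpace : NormedSpace ℂ V]
  [finiteDimensional : FiniteDimensional ℂ V]
  /-- the covering homomorphism -/
  exp : V →+ Additive A.ComplexPoint
  exp_surjective : Function.Surjective exp
  isOpen_preimage (U : A.X.left.Opens) : IsOpen {v : V | (exp v).toMul.MemOpen U}
  differentiableOn (U : A.X.left.Opens) (f : Γ(A.X.left, U)) :
    DifferentiableOn ℂ (fun v ↦ (exp v).toMul.eval f) {v : V | (exp v).toMul.MemOpen U}
  discreteTopology_ker : DiscreteTopology (AddSubgroup.toIntSubmodule exp.ker)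
  isZLattice_ker : IsZLattice ℝ (AddSubgroup.toIntSubmodule exp.ker)
  /-- the antilinear map `F_∞` on `V` induced by `σ` -/
  frob : V →ₛₗ[starRingEnd ℂ] V
  exp_frob (v : V) : (exp (frob v)).toMul = (exp v).toMul.conj

attribute [instance] Uniformization.normedAddCommGroup Uniformization.normedSpace
  Uniformization.finiteDimensional

/-- The lattice `Λ = H₁(A(ℂ), ℤ)`, as a subgroup of `V = Λ ⊗ ℝ`. -/
def Uniformization.lattice (u : Uniformization A) : Submodule ℤ u.V :=
  AddSubgroup.toIntSubmodule u.exp.ker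

/-- A polarization on `A`: an alternating form `E : Λ × Λ → ℤ` (given by its real bilinear
extension to `V = Λ ⊗ ℝ`) such that `F_∞^* E = -E` and such that
`H(x, y) = E(ix, y) + i E(x, y)` is a positive definite hermitian form on `V`. -/
structure Polarization (u : Uniformization A) where
  /-- the alternating form -/
  E : u.V →ₗ[ℝ] u.V →ₗ[ℝ] ℝ
  alternating (x : u.V) : E x x = 0
  integral (x y : u.V) (hx : x ∈ u.lattice) (hy : y ∈ u.lattice) : ∃ n : ℤ, E x y = n
  frob_frob (x y : u.V) : E (u.frob x) (u.frob y) = - E x y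
  hermitian (x y : u.V) :
    (E (Complex.I • x) y + Complex.I * E x y : ℂ) =
      starRingEnd ℂ (E (Complex.I • y) x + Complex.I * E y x : ℂ)
  posDef (x : u.V) (hx : x ≠ 0) : 0 < E (Complex.I • x) x

/-- The polarization is principal: the form `E : Λ × Λ → ℤ` is unimodular, that is, the map
`Λ → Hom(Λ, ℤ)`, `x ↦ E(x, ·)`, which is the map induced on `H₁` by the isogeny from `A` to the dual
abelian variety, is bijective. -/
def Polarization.IsPrincipal {u : Uniformization A} (P : Polarization u) : Prop :=
  ∀ l : u.lattice →+ ℤ, ∃! x : u.lattice, ∀ y : u.lattice, P.E x y = l y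

/-- An isogeny of abelian varieties over `ℝ`: a finite surjective homomorphism. -/
structure IsIsogeny (φ : A.X ⟶ B.X) : Prop where
  isMonHom : IsMonHom φ
  isFinite : IsFinite φ.left
  surjective : Surjective φ.left

/-- `φ^* Q = P`: with `φ_*` the (unique) complex linear map of universal coverings which lifts
`φ : A(ℂ) → B(ℂ)`, i.e. the map induced by `φ` on `H₁( - , ℤ) ⊗ ℝ`, one has
`Q(φ_* x, φ_* y) = P(x, y)`. -/
def PullbackEq {u : Uniformization A} {w : Uniformization B} (φ : A.X ⟶ B.X)
    (Q : Polarization w) (P : Polarization u) : Prop :=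
  ∃ L : u.V →ₗ[ℂ] w.V, (∀ v, (w.exp (L v)).toMul = ComplexPoint.map φ (u.exp v).toMul) ∧
    ∀ x y, Q.E (L x) (L y) = P.E x y

end RealAbelianVariety

end

/-!
Write `E` and `F` for the polarization form and for the lift of complex conjugation on `V`, with
`A(ℂ) = V / Λ`. The isogeny is the quotient of `A` by a suitable finite subgroup.

*The lattice.* `F` is an involution: `F² - 1` maps `V` linearly into the discrete group `Λ`. Among
the lattices `M ⊇ Λ` which are stable under `F` and on which `E` is integral there is a maximal
one, as they all lie in the dual of `Λ`. A maximal `M` is unimodular. If `x` lies in the dual of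
`M`, then `x + F x` lies there too and is fixed by `F`, so it can be added to `M` (`E` being
alternating) and belongs to `M` by maximality. Hence `F x ≡ -x` modulo `M`, so `M + ℤ x` is stable
under `F` and admissible, and `x ∈ M`. This is `ZLattice.exists_unimodular`.

*The quotient.* The image `H` of `M` in `A(ℂ)` is a finite subgroup, stable under complex
conjugation. The quotient `B = A / H` is constructed as the quotient of `A ×_ℝ Spec ℂ` by the
semidirect product `Γ` of `H` with `Gal(ℂ / ℝ)`. If `n` is an exponent of `H`, the morphism
`A ×_ℝ Spec ℂ ⟶ A`, `(a, z) ↦ n a`, is invariant under `Γ`, and it is finite, by Zariski's Main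
Theorem and the finiteness of the `n`-torsion (`RealAbelianVariety.isFinite_pow`). So the quotient
is the relative spectrum over `A` of the sheaf of invariant functions (`RelativeAction.quotient`),
and no quasi-projectivity is needed. Since `Γ` acts freely on points with values in fields, the
Galois coordinates of Chase, Harrison and Rosenberg show that the quotient map is étale
(`etale_of_free_action`), and Dedekind's independence of characters that `Γ` is transitive on the
field-valued points in its fibres (`exists_comp_smul_eq_of_free_action`). By étale descent,
morphisms which are invariant under `Γ` factor through `B` (`IsGaloisCover.exists_desc`). This
gives the map `A ⟶ B` and the group law on `B`.

*Conclusion.* `B` is finite over `A` by the map induced by multiplication by `n`, hence proper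
over `ℝ`. It is geometrically reduced as a flat quotient of `A ×_ℝ Spec ℂ`, geometrically
irreducible as an image of `A`, and hence smooth because it is a group scheme. Finally
`B(ℂ) = A(ℂ) / H = V / M`, since the kernel of `A(ℂ) → B(ℂ)` is `H`, so `V` also uniformizes `B`,
and the same form `E` is a principal polarization on `B` which pulls back to the given one along
the identity of `V`.
-/

/-! ### Free actions of finite groups on commutative rings -/

section FreeAction

open scoped TensorProduct

/-- Galois coordinates of Chase–Harrison–Rosenberg: if no maximal ideal is fixed by a nontrivial
element with trivial action on the residue field, then there is an element `∑ xᵢ ⊗ yᵢ` of the tensor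
square which the maps `a ⊗ b ↦ a * g • b` separate, i.e. send to `1` for `g = 1` and to `0`
otherwise. -/
theorem exists_galois_coordinates {C Γ : Type*} [CommRing C] [Group Γ] [Finite Γ]
    [MulSemiringAction Γ C]
    (hfree : ∀ g : Γ, g ≠ 1 → Ideal.span (Set.range fun c : C ↦ c - g • c) = ⊤) :
    ∃ (n : ℕ) (x y : Fin n → C), ∑ i, x i * y i = 1 ∧ ∀ g : Γ, g ≠ 1 → ∑ i, x i * g • y i = 0 := by
  classical
  have := Fintype.ofFinite Γ
  -- A family with vanishing sums for one element `g` is easy to find; families for different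
  -- elements are multiplied as elements of the tensor square.
  have key : ∀ s : Finset Γ, (1 : Γ) ∉ s → ∃ (n : ℕ) (x y : Fin n → C),
      ∑ i, x i * y i = 1 ∧ ∀ g ∈ s, ∑ i, x i * g • y i = 0 := by
    intro s
    induction s using Finset.induction_on with
    | empty => exact fun _ ↦ ⟨1, fun _ ↦ 1, fun _ ↦ 1, by simp, by simp⟩
    | insert g s hgs ih =>
      intro h1
      rw [Finset.mem_insert, not_or] at h1
      obtain ⟨n, x, y, hxy, hs⟩ := ih h1.2
      have hs' := (Ideal.eq_top_iff_one _).1 (hfree g (Ne.symm h1.1))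
      rw [Ideal.span, Finsupp.mem_span_range_iff_exists_finsupp] at hs'
      obtain ⟨f, hf⟩ := hs'
      -- `f = ∑ aⱼ (bⱼ - g bⱼ) = 1`; take the pairs `(aⱼ, bⱼ)` and `(-∑ aⱼ g bⱼ, 1)`
      let e := f.support.equivFin
      let m := f.support.card
      let b : Fin m → C := fun j ↦ (e.symm j : C)
      let a : Fin m → C := fun j ↦ f (b j)
      have hab : ∑ j, a j * (b j - g • b j) = 1 := by
        rw [← hf]
        exact (Equiv.sum_comp e.symm (fun c : f.support ↦ f c * ((c : C) - g • (c : C)))).trans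
          (Finset.sum_coe_sort f.support fun c ↦ f c * (c - g • c))
      let x' : Fin (m + 1) → C := Fin.snoc a (-∑ j, a j * g • b j)
      let y' : Fin (m + 1) → C := Fin.snoc b 1
      have h1' : ∑ j, x' j * y' j = 1 := by
        rw [Fin.sum_univ_castSucc]
        simp only [x', y', Fin.snoc_castSucc, Fin.snoc_last, mul_one]
        rw [← hab, ← Finset.sum_neg_distrib, ← Finset.sum_add_distrib]
        exact Finset.sum_congr rfl fun j _ ↦ by ring
      have h2' : ∑ j, x' j * g • y' j = 0 := by
        rw [Fin.sum_univ_castSucc]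
        simp [x', y']
      let E := finProdFinEquiv (m := n) (n := m + 1)
      have hprod : ∀ h' : Γ, ∑ k, (x (E.symm k).1 * x' (E.symm k).2) *
          h' • (y (E.symm k).1 * y' (E.symm k).2) =
          (∑ i, x i * h' • y i) * ∑ j, x' j * h' • y' j := by
        intro h'
        rw [Equiv.sum_comp E.symm (fun p ↦ (x p.1 * x' p.2) * h' • (y p.1 * y' p.2)),
          Fintype.sum_prod_type, Finset.sum_mul_sum]
        refine Finset.sum_congr rfl fun i _ ↦ Finset.sum_congr rfl fun j _ ↦ ?_
        rw [smul_mul']; ring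
      refine ⟨n * (m + 1), fun k ↦ x (E.symm k).1 * x' (E.symm k).2,
        fun k ↦ y (E.symm k).1 * y' (E.symm k).2, ?_, ?_⟩
      · have := hprod 1
        simp only [one_smul] at this
        rw [this, hxy, h1', one_mul]
      · intro h' hh'
        rw [hprod]
        rcases Finset.mem_insert.1 hh' with rfl | hh'
        · rw [h2', mul_zero]
        · rw [hs h' hh', zero_mul]
  obtain ⟨n, x, y, h1, h2⟩ := key (Finset.univ.erase 1) (by simp)
  exact ⟨n, x, y, h1, fun g hg ↦ h2 g (by simp [hg])⟩

/-- The trace of an element for a finite group action descends to the ring of invariants. -/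
theorem exists_algebraMap_eq_sum_smul (S : Type*) {C G : Type*} [CommRing S] [CommRing C]
    [Algebra S C] [Group G] [Fintype G] [MulSemiringAction G C] [Algebra.IsInvariant S C G]
    (c : C) : ∃ s : S, algebraMap S C s = ∑ g : G, g • c := by
  refine Algebra.IsInvariant.isInvariant (G := G) _ fun h ↦ ?_
  rw [Finset.smul_sum]
  simp only [smul_smul]
  exact Equiv.sum_comp (Equiv.mulLeft h) (fun g ↦ g • c)

/-- A finite free action yields a dual basis given by traces: `c = ∑ xᵢ tr (yᵢ c)`, where the
trace is regarded as a linear form with values in the ring of invariants. -/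
theorem exists_trace_dual_basis (S : Type*) {C G : Type*} [CommRing S] [CommRing C]
    [Algebra S C] [Group G] [Fintype G] [MulSemiringAction G C] [Algebra.IsInvariant S C G]
    [SMulCommClass G S C] (hS : Function.Injective (algebraMap S C))
    (hfree : ∀ g : G, g ≠ 1 → Ideal.span (Set.range fun c : C ↦ c - g • c) = ⊤) :
    ∃ (tr : C →ₗ[S] S) (n : ℕ) (x y : Fin n → C),
      (∀ c, algebraMap S C (tr c) = ∑ g : G, g • c) ∧
      (∀ c, ∑ i, tr (y i * c) • x i = c) ∧ ∑ i, x i * y i = 1 := by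
  classical
  obtain ⟨n, x, y, hxy1, hxy⟩ := exists_galois_coordinates hfree
  choose t ht using exists_algebraMap_eq_sum_smul S (G := G) (C := C)
  let tr : C →ₗ[S] S :=
    { toFun := t
      map_add' := fun a b ↦ hS (by simp [ht, Finset.sum_add_distrib])
      map_smul' := fun s b ↦ hS (by
        simp only [ht, smul_eq_mul, map_mul, RingHom.id_apply, Finset.mul_sum]
        refine Finset.sum_congr rfl fun g _ ↦ ?_
        rw [smul_comm, Algebra.smul_def]) }
  refine ⟨tr, n, x, y, ht, fun c ↦ ?_, hxy1⟩
  have : ∀ i, tr (y i * c) • x i = ∑ g : G, (x i * g • y i) * g • c := by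
    intro i
    rw [Algebra.smul_def]
    change algebraMap S C (t _) * _ = _
    rw [ht, Finset.sum_mul]
    refine Finset.sum_congr rfl fun g _ ↦ ?_
    rw [smul_mul']; ring
  simp only [this]
  rw [Finset.sum_comm]
  simp only [← Finset.sum_mul]
  rw [Finset.sum_eq_single 1 (fun g _ hg ↦ by rw [hxy g hg, zero_mul]) (by simp)]
  simp [hxy1]

/-- If a finite group `G` acts freely on a ring `C`, then `C` is a finite projective module over its
ring of invariants. -/
theorem finite_projective_of_free_action (S C G : Type*) [CommRing S] [CommRing C]
    [Algebra S C] [Group G] [Finite G] [MulSemiringAction G C] [Algebra.IsInvariant S C G]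
    [SMulCommClass G S C] (hS : Function.Injective (algebraMap S C))
    (hfree : ∀ g : G, g ≠ 1 → Ideal.span (Set.range fun c : C ↦ c - g • c) = ⊤) :
    Module.Finite S C ∧ Module.Projective S C := by
  have := Fintype.ofFinite G
  obtain ⟨tr, n, x, y, -, h, -⟩ := exists_trace_dual_basis S hS hfree
  let i : C →ₗ[S] (Fin n → S) := LinearMap.pi fun k ↦ tr ∘ₗ LinearMap.mulLeft S (y k)
  let p : (Fin n → S) →ₗ[S] C := Fintype.linearCombination S x
  have hpi : p ∘ₗ i = LinearMap.id := by
    ext c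
    simpa [p, i, Fintype.linearCombination_apply] using h c
  refine ⟨Module.Finite.of_surjective p ?_, Module.Projective.of_split i p hpi⟩
  exact Function.LeftInverse.surjective (LinearMap.congr_fun hpi)

/-- If a finite group `G` acts freely on a ring `C`, then `C` is unramified over its ring of
invariants: the Galois coordinates form a separability idempotent. -/
theorem formallyUnramified_of_free_action (S C G : Type*) [CommRing S] [CommRing C]
    [Algebra S C] [Group G] [Finite G] [MulSemiringAction G C] [Algebra.IsInvariant S C G]
    [SMulCommClass G S C] (hS : Function.Injective (algebraMap S C))
    (hfree : ∀ g : G, g ≠ 1 → Ideal.span (Set.range fun c : C ↦ c - g • c) = ⊤) :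
    Algebra.FormallyUnramified S C := by
  have := Fintype.ofFinite G
  have := (finite_projective_of_free_action S C G hS hfree).1
  obtain ⟨tr, n, x, y, -, h, h1⟩ := exists_trace_dual_basis S hS hfree
  -- `s * yᵢ` is expanded by the dual basis, and the traces are moved across the tensor product.
  have swap : ∀ s : C, ∑ i, x i ⊗ₜ[S] (s * y i) = ∑ i, (s * y i) ⊗ₜ[S] x i := by
    intro s
    calc ∑ i, x i ⊗ₜ[S] (s * y i)
        = ∑ i, ∑ j, (tr (y j * (s * y i)) • x i) ⊗ₜ[S] x j := by
          refine Finset.sum_congr rfl fun i _ ↦ ?_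
          conv_lhs => rw [← h (s * y i), TensorProduct.tmul_sum]
          simp only [TensorProduct.tmul_smul, TensorProduct.smul_tmul']
      _ = ∑ j, (∑ i, tr (y i * (s * y j)) • x i) ⊗ₜ[S] x j := by
          rw [Finset.sum_comm]
          simp only [TensorProduct.sum_tmul]
          refine Finset.sum_congr rfl fun j _ ↦ Finset.sum_congr rfl fun i _ ↦ ?_
          rw [show y j * (s * y i) = y i * (s * y j) by ring]
      _ = _ := by simp only [h]
  refine Algebra.FormallyUnramified.iff_exists_tensorProduct.2
    ⟨∑ i, x i ⊗ₜ[S] y i, fun s ↦ ?_, by simpa using h1⟩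
  have swap1 := swap 1
  simp only [one_mul] at swap1
  rw [sub_mul, sub_eq_zero]
  conv_rhs => rw [swap1]
  simpa [Finset.mul_sum] using swap s

/-- If a finite group acts freely on a ring `C` and the ring of invariants is Noetherian, then `C`
is étale over it. -/
theorem etale_of_free_action (S C G : Type*) [CommRing S] [CommRing C] [IsNoetherianRing S]
    [Algebra S C] [Group G] [Finite G] [MulSemiringAction G C] [Algebra.IsInvariant S C G]
    [SMulCommClass G S C] (hS : Function.Injective (algebraMap S C))
    (hfree : ∀ g : G, g ≠ 1 → Ideal.span (Set.range fun c : C ↦ c - g • c) = ⊤) :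
    Algebra.Etale S C := by
  obtain ⟨_, _⟩ := finite_projective_of_free_action S C G hS hfree
  have := formallyUnramified_of_free_action S C G hS hfree
  have : Algebra.FinitePresentation S C := Algebra.FinitePresentation.of_finiteType.1 inferInstance
  exact Algebra.Etale.of_formallyUnramified_of_flat

/-- If a finite group acts freely on a ring `C`, then two points of `C` with values in a field
which agree on the invariants differ by an element of the group. By the trace formula the second
point is a linear combination of the conjugates of the first, so Dedekind's independence of
characters applies. -/
theorem exists_comp_smul_eq_of_free_action (S : Type*) {C G K : Type*} [CommRing S] [CommRing C]
    [Field K] [Algebra S C] [Group G] [Finite G] [MulSemiringAction G C]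
    [Algebra.IsInvariant S C G] [SMulCommClass G S C]
    (hS : Function.Injective (algebraMap S C))
    (hfree : ∀ g : G, g ≠ 1 → Ideal.span (Set.range fun c : C ↦ c - g • c) = ⊤)
    (α β : C →+* K) (hαβ : ∀ s : S, α (algebraMap S C s) = β (algebraMap S C s)) :
    ∃ g : G, ∀ c, β c = α (g • c) := by
  classical
  have := Fintype.ofFinite G
  obtain ⟨tr, n, x, y, htr, h, -⟩ := exists_trace_dual_basis S hS hfree
  let χ : G → C →* K := fun g ↦
    (α.comp (MulSemiringAction.toRingHom G C g)).toMonoidHom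
  by_contra! hne
  have hli := linearIndependent_monoidHom C K
  have hnot : (β : C →* K) ∉ Set.range χ := by
    rintro ⟨g, hg⟩
    obtain ⟨c, hc⟩ := hne g
    exact hc (DFunLike.congr_fun hg c).symm
  have hmem : (fun f : C →* K ↦ (f : C → K)) (β : C →* K) ∈
      Submodule.span K ((fun f : C →* K ↦ (f : C → K)) '' Set.range χ) := by
    have : (fun f : C →* K ↦ (f : C → K)) (β : C →* K) =
        ∑ g : G, (∑ i, β (x i) * α (g • y i)) • (χ g : C → K) := by
      ext c
      simp only [Finset.sum_apply, Pi.smul_apply, smul_eq_mul]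
      change β c = ∑ g : G, (∑ i, β (x i) * α (g • y i)) * α (g • c)
      conv_lhs => rw [← h c]
      simp only [map_sum, Algebra.smul_def, map_mul, ← hαβ]
      simp only [htr, map_sum, smul_mul', map_mul, Finset.sum_mul]
      rw [Finset.sum_comm]
      refine Finset.sum_congr rfl fun g _ ↦ Finset.sum_congr rfl fun i _ ↦ by ring
    rw [this]
    exact Submodule.sum_mem _ fun g _ ↦ Submodule.smul_mem _ _
      (Submodule.subset_span ⟨_, ⟨g, rfl⟩, rfl⟩)
  exact LinearIndependent.notMem_span_image hli hnot hmem

end FreeAction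

/-! ### The quotient of a relatively affine scheme by a finite group -/

namespace AlgebraicGeometry

universe u

open Limits Opposite Scheme.AffineZariskiSite

noncomputable section

/-- An action of the group `G` on the scheme `X` over `Y`, for a morphism `f : X ⟶ Y`. It is a right
action on `X`, so that the action on functions by pullback is a left action. -/
structure RelativeAction {X Y : Scheme.{u}} (f : X ⟶ Y) (G : Type*) [Group G] where
  /-- the action, by endomorphisms of `X` -/
  hom : G → (X ⟶ X)
  hom_one : hom 1 = 𝟙 X
  hom_mul (g h : G) : hom (g * h) = hom g ≫ hom h
  hom_comp (g : G) : hom g ≫ f = f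

/-- Restriction of functions between inverse images of open subsets of `Y`. -/
abbrev Scheme.Hom.preimageRes {X Y : Scheme.{u}} (f : X ⟶ Y)
    {U V : Y.Opens} (i : U ≤ V) : Γ(X, f ⁻¹ᵁ V) ⟶ Γ(X, f ⁻¹ᵁ U) :=
  X.presheaf.map (homOfLE (f.preimage_mono i)).op

namespace RelativeAction

variable {X Y : Scheme.{u}} {f : X ⟶ Y} {G : Type*} [Group G] (ρ : RelativeAction f G)

lemma preimage_le (g : G) (U : Y.Opens) : f ⁻¹ᵁ U ≤ ρ.hom g ⁻¹ᵁ f ⁻¹ᵁ U := by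
  rw [← Scheme.Hom.comp_preimage, ρ.hom_comp]

/-- The action of `g` on the functions on the inverse image of an open subset of `Y`. -/
def pull (g : G) (U : Y.Opens) : Γ(X, f ⁻¹ᵁ U) →+* Γ(X, f ⁻¹ᵁ U) :=
  ((ρ.hom g).appLE (f ⁻¹ᵁ U) (f ⁻¹ᵁ U) (ρ.preimage_le g U)).hom

lemma pull_one (U : Y.Opens) : ρ.pull 1 U = RingHom.id _ := by
  have (h : X ⟶ X) (hh : h = 𝟙 X) (e) : h.appLE (f ⁻¹ᵁ U) (f ⁻¹ᵁ U) e = 𝟙 _ := by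
    subst hh
    rw [Scheme.Hom.appLE, Scheme.Hom.id_app]
    exact (Category.id_comp _).trans (X.presheaf.map_id _)
  rw [pull, this _ ρ.hom_one]
  rfl

lemma pull_mul (g h : G) (U : Y.Opens) : ρ.pull (g * h) U = (ρ.pull g U).comp (ρ.pull h U) := by
  simp only [pull, ← CommRingCat.hom_comp, Scheme.Hom.appLE_comp_appLE, ρ.hom_mul]

/-- The action of `G` on the ring of functions on the inverse image of an open subset. -/
abbrev mulSemiringAction (U : Y.Opens) : MulSemiringAction G Γ(X, f ⁻¹ᵁ U) where
  smul g c := ρ.pull g U c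
  one_smul c := by change ρ.pull 1 U c = c; rw [pull_one]; rfl
  mul_smul g h c := by change ρ.pull (g * h) U c = _; rw [pull_mul]; rfl
  smul_zero g := map_zero (ρ.pull g U)
  smul_add g := map_add (ρ.pull g U)
  smul_one g := map_one (ρ.pull g U)
  smul_mul g := map_mul (ρ.pull g U)

/-- The ring of invariant functions on the inverse image of an open subset. -/
def invariants (U : Y.Opens) : Subring Γ(X, f ⁻¹ᵁ U) where
  carrier := {c | ∀ g, ρ.pull g U c = c}
  mul_mem' ha hb g := by rw [map_mul, ha, hb]
  one_mem' g := map_one _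
  add_mem' ha hb g := by rw [map_add, ha, hb]
  zero_mem' g := map_zero _
  neg_mem' ha g := by rw [map_neg, ha]

lemma pull_res (g : G) {U V : Y.Opens} (i : U ≤ V) (c : Γ(X, f ⁻¹ᵁ V)) :
    ρ.pull g U (f.preimageRes i c) = f.preimageRes i (ρ.pull g V c) := by
  simp only [pull, ← CommRingCat.comp_apply, Scheme.Hom.map_appLE, Scheme.Hom.appLE_map]

lemma pull_app (g : G) (U : Y.Opens) (s : Γ(Y, U)) : ρ.pull g U (f.app U s) = f.app U s := by
  have h := Scheme.Hom.appLE_comp_appLE (ρ.hom g) f U (f ⁻¹ᵁ U) (f ⁻¹ᵁ U) le_rfl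
    (ρ.preimage_le g U)
  rw [← Scheme.Hom.app_eq_appLE] at h
  have (k : X ⟶ Y) (hk : k = f) (e) : k.appLE U (f ⁻¹ᵁ U) e = f.app U := by
    subst hk
    rw [Scheme.Hom.app_eq_appLE]
  rw [this _ (ρ.hom_comp g)] at h
  exact congr($h s)

/-- The presheaf of invariants `(f_* 𝒪_X)^G` on `Y`. -/
def diagram : Y.Opensᵒᵖ ⥤ CommRingCat.{u} where
  obj U := .of (ρ.invariants U.unop)
  map {V U} i := CommRingCat.ofHom ((f.preimageRes i.unop.le).hom.restrict _ _ fun c hc g ↦ by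
    refine (ρ.pull_res g i.unop.le c).trans ?_
    rw [hc])
  map_id U := by
    ext c
    change X.presheaf.map (𝟙 _) c.1 = _
    rw [X.presheaf.map_id]
    rfl
  map_comp i j := by
    ext c
    change X.presheaf.map _ c.1 = X.presheaf.map _ (X.presheaf.map _ c.1)
    rw [← CommRingCat.comp_apply, ← X.presheaf.map_comp]
    rfl

/-- The structure map `𝒪_Y ⟶ (f_* 𝒪_X)^G`. -/
def diagramMap : Y.presheaf ⟶ ρ.diagram where
  app U := CommRingCat.ofHom ((f.app U.unop).hom.codRestrict (ρ.invariants U.unop)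
    fun s g ↦ ρ.pull_app g U.unop s)
  naturality {U V} i := by ext x; exact Subtype.ext congr($(f.naturality i) x)

/-- The inclusion of the invariants. -/
def incl (U : Y.Opens) : ρ.diagram.obj (op U) ⟶ Γ(X, f ⁻¹ᵁ U) :=
  CommRingCat.ofHom (ρ.invariants U).subtype

lemma diagramMap_incl (U : Y.Opens) : ρ.diagramMap.app (op U) ≫ ρ.incl U = f.app U := rfl

lemma incl_injective (U : Y.Opens) : Function.Injective (ρ.incl U) := Subtype.val_injective

variable [IsAffineHom f] [Finite G]

lemma isLocalization_preimageRes {U : Y.Opens} (hU : IsAffineOpen U) (r : Γ(Y, U)) :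
    letI := (f.preimageRes (Y.basicOpen_le r)).hom.toAlgebra
    IsLocalization.Away (f.app U r) Γ(X, f ⁻¹ᵁ Y.basicOpen r) := by
  have e : X.basicOpen (f.app U r) = f ⁻¹ᵁ Y.basicOpen r := (f.preimage_basicOpen r).symm
  exact (hU.preimage f).isLocalization_of_eq_basicOpen (f.app U r) _ e.symm

/-- Invariants of a finite group commute with localization at a function on the base; this is the
quasi-coherence of `(f_* 𝒪_X)^G`, by which the spectra of the rings of invariants can
be glued. -/
lemma coequifibered_diagramMap :
    ((toOpensFunctor Y).op.whiskerLeft ρ.diagramMap).Coequifibered := by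
  refine coequifibered_iff_forall_isLocalizationAway.mpr fun U r ↦ ?_
  have hloc := isLocalization_preimageRes (f := f) U.2 r
  let := (f.preimageRes (Y.basicOpen_le r)).hom.toAlgebra
  let alg : Algebra (ρ.invariants U.1) (ρ.invariants (Y.basicOpen r)) :=
    (ρ.diagram.map (homOfLE (Y.basicOpen_le r)).op).hom.toAlgebra
  have hval : ∀ s : ρ.invariants U.1, (algebraMap (ρ.invariants U.1)
    (ρ.invariants (Y.basicOpen r)) s : Γ(X, f ⁻¹ᵁ Y.basicOpen r)) =
      algebraMap Γ(X, f ⁻¹ᵁ U.1) Γ(X, f ⁻¹ᵁ Y.basicOpen r) s := fun s ↦ rfl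
  let rr : ρ.invariants U.1 := ρ.diagramMap.app (.op U.1) r
  have hrr : (rr : Γ(X, f ⁻¹ᵁ U.1)) = f.app U.1 r := rfl
  change IsLocalization.Away rr (ρ.invariants (Y.basicOpen r))
  have hpull : ∀ (g : G) (c : Γ(X, f ⁻¹ᵁ U.1)), ρ.pull g (Y.basicOpen r)
      (algebraMap _ _ c) = algebraMap _ _ (ρ.pull g U.1 c) :=
    fun g c ↦ ρ.pull_res g (Y.basicOpen_le r) c
  have hpullr : ∀ (g : G) (n : ℕ), ρ.pull g U.1 (f.app U.1 r ^ n) = f.app U.1 r ^ n :=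
    fun g n ↦ by rw [map_pow, ρ.pull_app]
  refine IsLocalization.Away.mk rr ?_ ?_ ?_
  · have hu : IsUnit (algebraMap _ Γ(X, f ⁻¹ᵁ Y.basicOpen r) (f.app U.1 r)) :=
      IsLocalization.Away.algebraMap_isUnit _
    obtain ⟨v, hv⟩ := hu.exists_right_inv
    have hvi : v ∈ ρ.invariants (Y.basicOpen r) := fun g ↦ by
      have h1 := congrArg (ρ.pull g (Y.basicOpen r)) hv
      rw [map_mul, hpull, ρ.pull_app, map_one] at h1
      exact hu.mul_left_cancel (h1.trans hv.symm)
    exact IsUnit.of_mul_eq_one ⟨v, hvi⟩ (Subtype.ext hv)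
  · intro s
    obtain ⟨n, a, ha⟩ := IsLocalization.Away.surj (f.app U.1 r) s.1
    -- `a` is invariant up to a power of `r`, and one power suffices for all of the finite group
    have h1 : ∀ g : G, ∃ k : ℕ, f.app U.1 r ^ k * ρ.pull g U.1 a = f.app U.1 r ^ k * a := by
      intro g
      refine IsLocalization.Away.exists_of_eq (S := Γ(X, f ⁻¹ᵁ Y.basicOpen r)) _ ?_
      rw [← hpull, ← ha, map_mul, map_pow, hpull, ρ.pull_app, s.2]
    choose k hk using h1
    have := Fintype.ofFinite G
    let N := Finset.univ.sup k
    have hN : f.app U.1 r ^ N * a ∈ ρ.invariants U.1 := fun g ↦ by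
      obtain ⟨j, hj⟩ := Nat.exists_eq_add_of_le (Finset.le_sup (f := k) (Finset.mem_univ g))
      rw [map_mul, hpullr, show N = j + k g by omega, pow_add, mul_assoc, hk, ← mul_assoc]
    refine ⟨N + n, ⟨_, hN⟩, Subtype.ext ?_⟩
    change s.1 * (algebraMap _ _ (f.app U.1 r)) ^ (N + n) = algebraMap _ _ (f.app U.1 r ^ N * a)
    rw [map_mul, map_pow, ← ha]
    ring
  · intro a b hab
    obtain ⟨n, hn⟩ := IsLocalization.Away.exists_of_eq (S := Γ(X, f ⁻¹ᵁ Y.basicOpen r))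
      (f.app U.1 r) (congrArg Subtype.val hab)
    exact ⟨n, Subtype.ext hn⟩

end RelativeAction
end
end AlgebraicGeometry

/-! ### The quotient map and its étaleness for free actions -/

namespace AlgebraicGeometry.RelativeAction

universe u

open Limits Opposite Scheme.AffineZariskiSite

noncomputable section

section

variable {X Y : Scheme.{u}} {f : X ⟶ Y} {G : Type*} [Group G] (ρ : RelativeAction f G)
  [IsAffineHom f] [Finite G]

/-- The diagram of spectra of invariants which is glued to form the quotient. -/
def glueData := relativeGluingData ρ.coequifibered_diagramMap

instance : (ρ.glueData.functor ⋙ Scheme.forget).IsLocallyDirected :=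
  Scheme.Cover.RelativeGluingData.instIsLocallyDirectedI₀CompFunctorForgetOfIsThin ..

/-- The quotient `X / G`, the relative spectrum of `(f_* 𝒪_X)^G` over `Y`. -/
def quotient : Scheme.{u} := ρ.glueData.glued

/-- The open cover of the quotient by the spectra of the rings of invariants. -/
def cover : ρ.quotient.OpenCover := ρ.glueData.cover

/-- The structure map of the quotient. -/
def toBase : ρ.quotient ⟶ Y := ρ.glueData.toBase

/-- The affine open piece of the quotient over an affine open subset of the base. -/
def chart (U : Y.AffineZariskiSite) : Spec (ρ.diagram.obj (op U.1)) ⟶ ρ.quotient := ρ.cover.f U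

instance (U : Y.AffineZariskiSite) : IsOpenImmersion (ρ.chart U) := ρ.cover.map_prop U

lemma chart_toBase (U : Y.AffineZariskiSite) :
    ρ.chart U ≫ ρ.toBase = Spec.map (ρ.diagramMap.app (op U.1)) ≫ U.2.fromSpec :=
  colimit.ι_desc _ _

lemma toBase_preimage (U : Y.AffineZariskiSite) : ρ.toBase ⁻¹ᵁ U.1 = (ρ.chart U).opensRange := by
  simpa using! ρ.glueData.toBase_preimage_eq_opensRange_ι U

lemma map_chart {U V : Y.AffineZariskiSite} (i : U ⟶ V) :
    Spec.map (ρ.diagram.map (homOfLE (toOpens_mono i.le)).op) ≫ ρ.chart V = ρ.chart U :=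
  colimit.w ρ.glueData.functor i

/-- The quotient map on the inverse image of an affine open subset of the base. -/
def projOn (U : Y.AffineZariskiSite) : (f ⁻¹ᵁ U.1).toScheme ⟶ ρ.quotient :=
  (f ⁻¹ᵁ U.1).toSpecΓ ≫ Spec.map (ρ.incl U.1) ≫ ρ.chart U

lemma homOfLE_projOn {U V : Y.AffineZariskiSite} (i : U ⟶ V) :
    X.homOfLE (f.preimage_mono (toOpens_mono i.le)) ≫ ρ.projOn V = ρ.projOn U := by
  rw [projOn, ← Scheme.Opens.toSpecΓ_SpecMap_presheaf_map_assoc, projOn, ← ρ.map_chart i,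
    ← Spec.map_comp_assoc, ← Spec.map_comp_assoc]
  rfl

/-- The cover of `X` by the inverse images of the affine open subsets of `Y`. -/
abbrev _root_.AlgebraicGeometry.Scheme.Hom.preimageCover {X Y : Scheme.{u}} (f : X ⟶ Y) :
    X.OpenCover where
  I₀ := Y.AffineZariskiSite
  X U := f ⁻¹ᵁ U.1
  f U := (f ⁻¹ᵁ U.1).ι
  mem₀ := by
    rw [Scheme.presieve₀_mem_precoverage_iff]
    refine ⟨fun x ↦ ?_, inferInstance⟩
    obtain ⟨U, hxU⟩ := TopologicalSpace.Opens.mem_iSup.mp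
      ((iSup_affineOpens_eq_top Y).ge (Set.mem_univ (f x)))
    exact ⟨U, ⟨x, hxU⟩, rfl⟩

instance {X Y : Scheme.{u}} (f : X ⟶ Y) : Category f.preimageCover.I₀ :=
  inferInstanceAs <| Category Y.AffineZariskiSite

/-- The transition maps of the cover by inverse images of affine open subsets. -/
def _root_.AlgebraicGeometry.Scheme.Hom.preimageCoverTrans {X Y : Scheme.{u}} (f : X ⟶ Y)
    {U V : Y.AffineZariskiSite} (i : U ⟶ V) :
    (f ⁻¹ᵁ U.1).toScheme ⟶ (f ⁻¹ᵁ V.1).toScheme :=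
  X.homOfLE (f.preimage_mono (toOpens_mono i.le))

lemma _root_.AlgebraicGeometry.Scheme.Hom.preimageCoverTrans_ι {X Y : Scheme.{u}} (f : X ⟶ Y)
    {U V : Y.AffineZariskiSite} (i : U ⟶ V) :
    f.preimageCoverTrans i ≫ (f ⁻¹ᵁ V.1).ι = (f ⁻¹ᵁ U.1).ι :=
  X.homOfLE_ι _

instance {X Y : Scheme.{u}} (f : X ⟶ Y) {U V : Y.AffineZariskiSite} (i : U ⟶ V) :
    IsOpenImmersion (f.preimageCoverTrans i) := by
  delta Scheme.Hom.preimageCoverTrans; infer_instance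

lemma pullback_fst_comp_lift_apply {X U V W : Scheme.{u}} (i : U ⟶ X) (j : V ⟶ X) (a : W ⟶ U)
    (b : W ⟶ V) (h : a ≫ i = b ≫ j) (w : W) :
    (pullback.fst i j ≫ i) (pullback.lift a b h w) = (a ≫ i) w := by
  rw [← Scheme.Hom.comp_apply, pullback.lift_fst_assoc]

instance {X Y : Scheme.{u}} (f : X ⟶ Y) : f.preimageCover.LocallyDirected where
  trans {U V} i := f.preimageCoverTrans i
  trans_id U := by
    rw [← cancel_mono (f ⁻¹ᵁ U.1).ι, f.preimageCoverTrans_ι, Category.id_comp]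
  trans_comp {U V W} i j := by
    rw [← cancel_mono (f ⁻¹ᵁ W.1).ι, f.preimageCoverTrans_ι, Category.assoc,
      f.preimageCoverTrans_ι, f.preimageCoverTrans_ι]
  w i := f.preimageCoverTrans_ι i
  directed {U V} x := by
    let p : pullback (f ⁻¹ᵁ U.1).ι (f ⁻¹ᵁ V.1).ι ⟶ X := pullback.fst _ _ ≫ (f ⁻¹ᵁ U.1).ι
    have haU : f (p x) ∈ U.1 := (pullback.fst (f ⁻¹ᵁ U.1).ι (f ⁻¹ᵁ V.1).ι x).2
    have haV : f (p x) ∈ V.1 := by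
      unfold p; rw [pullback.condition]
      exact (pullback.snd (f ⁻¹ᵁ U.1).ι (f ⁻¹ᵁ V.1).ι x).2
    obtain ⟨r, s, e, hx⟩ := exists_basicOpen_le_affine_inter U.2 V.2 _ ⟨haU, haV⟩
    refine ⟨U.basicOpen r, homOfLE (U.basicOpen_le r), eqToHom (Subtype.ext (by exact e)) ≫
      homOfLE (V.basicOpen_le s), ⟨p x, hx⟩, ?_⟩
    apply p.isOpenEmbedding.injective
    exact (pullback_fst_comp_lift_apply _ _ _ _ _ _).trans
      (congr($(f.preimageCoverTrans_ι (homOfLE (U.basicOpen_le r))) ⟨p x, hx⟩) :)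
  property_trans i := inferInstanceAs (IsOpenImmersion (f.preimageCoverTrans i))

/-- The quotient map `X ⟶ X / G`. -/
def proj : X ⟶ ρ.quotient :=
  f.preimageCover.glueMorphismsOfLocallyDirected (fun U ↦ ρ.projOn U) fun i ↦ ρ.homOfLE_projOn i

lemma ι_proj (U : Y.AffineZariskiSite) : (f ⁻¹ᵁ U.1).ι ≫ ρ.proj = ρ.projOn U :=
  Scheme.OpenCover.map_glueMorphismsOfLocallyDirected f.preimageCover _
    (fun i ↦ ρ.homOfLE_projOn i) U

lemma isAffineOpen_preimage (f : X ⟶ Y) [IsAffineHom f] (U : Y.AffineZariskiSite) :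
    IsAffineOpen (f ⁻¹ᵁ U.1) := U.2.preimage f

lemma fromSpec_proj (U : Y.AffineZariskiSite) :
    (isAffineOpen_preimage f U).fromSpec ≫ ρ.proj = Spec.map (ρ.incl U.1) ≫ ρ.chart U := by
  rw [← cancel_epi (isAffineOpen_preimage f U).isoSpec.hom, ← Category.assoc,
    IsAffineOpen.isoSpec_hom_fromSpec, ρ.ι_proj, projOn, IsAffineOpen.isoSpec_hom]

lemma hom_ext_preimage (f : X ⟶ Y) [IsAffineHom f] {Z : Scheme.{u}} {a b : X ⟶ Z}
    (h : ∀ U, (isAffineOpen_preimage f U).fromSpec ≫ a =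
      (isAffineOpen_preimage f U).fromSpec ≫ b) : a = b := by
  refine f.preimageCover.hom_ext _ _ fun (U : Y.AffineZariskiSite) ↦ ?_
  rw [← cancel_epi (isAffineOpen_preimage f U).isoSpec.inv]
  exact h U

lemma proj_toBase : ρ.proj ≫ ρ.toBase = f := by
  refine hom_ext_preimage f fun U ↦ ?_
  rw [← Category.assoc, ρ.fromSpec_proj, Category.assoc, ρ.chart_toBase,
    ← Spec.map_comp_assoc, ρ.diagramMap_incl, Scheme.Hom.app_eq_appLE,
    IsAffineOpen.SpecMap_appLE_fromSpec]

lemma hom_proj (g : G) : ρ.hom g ≫ ρ.proj = ρ.proj := by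
  refine hom_ext_preimage f fun U ↦ ?_
  rw [← IsAffineOpen.SpecMap_appLE_fromSpec_assoc (ρ.hom g) (isAffineOpen_preimage f U)
    (isAffineOpen_preimage f U) (ρ.preimage_le g U.1), ρ.fromSpec_proj, ← Spec.map_comp_assoc]
  congr 2
  ext c
  exact c.2 g

lemma isPullback_toBase (U : Y.AffineZariskiSite) :
    IsPullback (Spec.map (ρ.diagramMap.app (op U.1))) (ρ.chart U) U.2.fromSpec ρ.toBase :=
  IsOpenImmersion.isPullback _ _ _ _ (ρ.chart_toBase U)
    (by rw [IsAffineOpen.opensRange_fromSpec, ρ.toBase_preimage])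

lemma isPullback_proj (U : Y.AffineZariskiSite) :
    IsPullback (Spec.map (ρ.incl U.1)) (isAffineOpen_preimage f U).fromSpec
      (ρ.chart U) ρ.proj :=
  IsOpenImmersion.isPullback _ _ _ _ (ρ.fromSpec_proj U)
    (by rw [IsAffineOpen.opensRange_fromSpec, ← ρ.toBase_preimage, ← Scheme.Hom.comp_preimage,
      ρ.proj_toBase])

/-- A property which is local on the target can be checked on pullbacks along an open cover, with
any choice of pullback squares. -/
lemma of_isPullback_openCover (P : MorphismProperty Scheme.{u}) [IsZariskiLocalAtTarget P]
    {A B : Scheme.{u}} (φ : A ⟶ B) (𝒰 : B.OpenCover) (W : 𝒰.I₀ → Scheme.{u})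
    (a : ∀ i, W i ⟶ 𝒰.X i) (b : ∀ i, W i ⟶ A) (h : ∀ i, IsPullback (a i) (b i) (𝒰.f i) φ)
    (ha : ∀ i, P (a i)) : P φ := by
  refine IsZariskiLocalAtTarget.of_openCover 𝒰 fun i ↦ ?_
  have e : (h i).flip.isoPullback.hom ≫ 𝒰.pullbackHom φ i = a i :=
    (h i).flip.isoPullback_hom_snd
  exact (P.cancel_left_of_respectsIso (h i).flip.isoPullback.hom (𝒰.pullbackHom φ i)).1
    (by rw [e]; exact ha i)

lemma proj_of_chart (P : MorphismProperty Scheme.{u}) [IsZariskiLocalAtTarget P]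
    (h : ∀ U : Y.AffineZariskiSite, P (Spec.map (ρ.incl U.1))) : P ρ.proj :=
  of_isPullback_openCover P ρ.proj ρ.cover _ _ _ ρ.isPullback_proj h

/-- The affine charts of `Y` indexed by its affine open subsets. -/
abbrev _root_.AlgebraicGeometry.Scheme.affineZariskiCover (Y : Scheme.{u}) : Y.OpenCover where
  I₀ := Y.AffineZariskiSite
  X U := Spec Γ(Y, U.1)
  f U := U.2.fromSpec
  mem₀ := by
    rw [Scheme.presieve₀_mem_precoverage_iff]
    refine ⟨fun x ↦ ?_, fun (U : Y.AffineZariskiSite) ↦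
      inferInstanceAs (IsOpenImmersion U.2.fromSpec)⟩
    obtain ⟨U, hxU⟩ := TopologicalSpace.Opens.mem_iSup.mp
      ((iSup_affineOpens_eq_top Y).ge (Set.mem_univ x))
    refine ⟨U, ?_⟩
    change x ∈ Set.range U.2.fromSpec
    rw [U.2.range_fromSpec]
    exact hxU

lemma toBase_of_chart (P : MorphismProperty Scheme.{u}) [IsZariskiLocalAtTarget P]
    (h : ∀ U : Y.AffineZariskiSite, P (Spec.map (ρ.diagramMap.app (op U.1)))) : P ρ.toBase :=
  of_isPullback_openCover P ρ.toBase Y.affineZariskiCover _ _ _ ρ.isPullback_toBase h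

end

section

variable {X Y : Scheme.{u}} {f : X ⟶ Y} {G : Type*} [Group G] (ρ : RelativeAction f G)
  [IsAffineHom f]

/-- For `f` finite and a Noetherian base, the invariants form a submodule of a Noetherian module. -/
lemma isFinite_diagramMap {f : X ⟶ Y} (ρ : RelativeAction f G) [IsFinite f]
    [IsLocallyNoetherian Y] (U : Y.AffineZariskiSite) :
    (ρ.diagramMap.app (op U.1)).hom.Finite := by
  have : IsNoetherianRing Γ(Y, U.1) := IsLocallyNoetherian.component_noetherian ⟨U.1, U.2⟩
  have h : (f.app U.1).hom.Finite := IsFinite.finite_app f U.1 U.2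
  algebraize [(f.app U.1).hom, (ρ.diagramMap.app (op U.1)).hom]
  have : Module.Finite Γ(Y, U.1) Γ(X, f ⁻¹ᵁ U.1) := h
  let l : (ρ.diagram.obj (op U.1)) →ₗ[Γ(Y, U.1)] Γ(X, f ⁻¹ᵁ U.1) :=
    { toFun := fun c ↦ ρ.incl U.1 c
      map_add' := fun a b ↦ map_add _ a b
      map_smul' := fun r a ↦ by
        rw [Algebra.smul_def, Algebra.smul_def, map_mul]
        rfl }
  exact Module.Finite.of_injective l (ρ.incl_injective U.1)

lemma isNoetherianRing_diagram {f : X ⟶ Y} (ρ : RelativeAction f G) [IsFinite f]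
    [IsLocallyNoetherian Y] (U : Y.AffineZariskiSite) :
    IsNoetherianRing (ρ.diagram.obj (op U.1)) := by
  have : IsNoetherianRing Γ(Y, U.1) := IsLocallyNoetherian.component_noetherian ⟨U.1, U.2⟩
  have h := ρ.isFinite_diagramMap U
  algebraize [(ρ.diagramMap.app (op U.1)).hom]
  have : Module.Finite Γ(Y, U.1) (ρ.diagram.obj (op U.1)) := h
  have := isNoetherian_of_isNoetherianRing_of_finite Γ(Y, U.1) (ρ.diagram.obj (op U.1))
  exact isNoetherian_of_tower Γ(Y, U.1) this

lemma isFinite_toBase {f : X ⟶ Y} (ρ : RelativeAction f G) [Finite G] [IsFinite f]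
    [IsLocallyNoetherian Y] : IsFinite ρ.toBase :=
  have : IsZariskiLocalAtTarget (@IsFinite.{u}) :=
    @HasAffineProperty.instIsZariskiLocalAtTarget @IsFinite _
      IsFinite.instHasAffinePropertyAndIsAffineFiniteCarrierObjOppositeOpensCarrierCarrierCommRingCatPresheafOpOpensTopHomAppTop
  ρ.toBase_of_chart @IsFinite fun U ↦ (IsFinite.SpecMap_iff _).2 (ρ.isFinite_diagramMap U)

/-- The action is free if no point with values in a field is fixed by a nontrivial element. -/
def IsFree : Prop :=
  ∀ (g : G) (K : Type u) [Field K] (x : Spec (.of K) ⟶ X), x ≫ ρ.hom g = x → g = 1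

variable {ρ}

/-- At a maximal ideal containing all `c - g c`, the residue field would give a fixed point. -/
lemma IsFree.span_eq_top (h : ρ.IsFree) (g : G) (hg : g ≠ 1) (U : Y.AffineZariskiSite) :
    Ideal.span (Set.range fun c : Γ(X, f ⁻¹ᵁ U.1) ↦ c - ρ.pull g U.1 c) = ⊤ := by
  by_contra hne
  obtain ⟨m, hm, hle⟩ := Ideal.exists_le_maximal _ hne
  let := Ideal.Quotient.field m
  refine hg (h g (Γ(X, f ⁻¹ᵁ U.1) ⧸ m) (Spec.map (CommRingCat.ofHom (Ideal.Quotient.mk m)) ≫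
    (isAffineOpen_preimage f U).fromSpec) ?_)
  rw [Category.assoc, ← IsAffineOpen.SpecMap_appLE_fromSpec (ρ.hom g) (isAffineOpen_preimage f U)
    (isAffineOpen_preimage f U) (ρ.preimage_le g U.1), ← Spec.map_comp_assoc]
  congr 2
  ext c
  refine (Ideal.Quotient.eq.2 (hle (Ideal.subset_span ⟨c, rfl⟩))).symm

lemma IsFree.etale_incl {f : X ⟶ Y} {ρ : RelativeAction f G} [Finite G] [IsFinite f]
    [IsLocallyNoetherian Y] (h : ρ.IsFree) (U : Y.AffineZariskiSite) : (ρ.incl U.1).hom.Etale := by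
  have := ρ.isNoetherianRing_diagram U
  let := ρ.mulSemiringAction U.1
  algebraize [(ρ.incl U.1).hom]
  have : Algebra.IsInvariant (ρ.diagram.obj (op U.1)) Γ(X, f ⁻¹ᵁ U.1) G :=
    ⟨fun c hc ↦ ⟨⟨c, hc⟩, rfl⟩⟩
  have : SMulCommClass G (ρ.diagram.obj (op U.1)) Γ(X, f ⁻¹ᵁ U.1) := ⟨fun g s c ↦ by
    rw [Algebra.smul_def, Algebra.smul_def, smul_mul']
    congr 1
    exact s.2 g⟩
  exact etale_of_free_action _ _ G (ρ.incl_injective U.1) fun g hg ↦ h.span_eq_top g hg U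

lemma IsFree.etale_proj {f : X ⟶ Y} {ρ : RelativeAction f G} [Finite G] [IsFinite f]
    [IsLocallyNoetherian Y] (h : ρ.IsFree) : Etale ρ.proj :=
  have : IsZariskiLocalAtTarget (@Etale.{u}) :=
    HasRingHomProperty.instIsZariskiLocalAtTarget @Etale
  ρ.proj_of_chart @Etale fun U ↦
    (HasRingHomProperty.Spec_iff (P := @Etale)).2 (h.etale_incl U)

lemma isIntegral_incl {f : X ⟶ Y} (ρ : RelativeAction f G) [Finite G] (U : Y.AffineZariskiSite) :
    (ρ.incl U.1).hom.IsIntegral := by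
  let := ρ.mulSemiringAction U.1
  algebraize [(ρ.incl U.1).hom]
  have : Algebra.IsInvariant (ρ.diagram.obj (op U.1)) Γ(X, f ⁻¹ᵁ U.1) G :=
    ⟨fun c hc ↦ ⟨⟨c, hc⟩, rfl⟩⟩
  exact (Algebra.IsInvariant.isIntegral (ρ.diagram.obj (op U.1)) Γ(X, f ⁻¹ᵁ U.1) G).isIntegral

instance surjective_proj [Finite G] : Surjective ρ.proj :=
  ρ.proj_of_chart @Surjective fun U ↦ by
    constructor
    exact (ρ.isIntegral_incl U).comap_surjective (ρ.incl_injective U.1)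

/-- Two points of `X` with values in a field which have the same image in the quotient by a free
action are conjugate. -/
lemma IsFree.exists_comp_hom_eq [Finite G] (h : ρ.IsFree) {K : Type u} [Field K]
    (x y : Spec (.of K) ⟶ X) (hxy : x ≫ ρ.proj = y ≫ ρ.proj) : ∃ g, y = x ≫ ρ.hom g := by
  let pt : Spec (.of K) := IsLocalRing.closedPoint K
  have hf : x ≫ f = y ≫ f := by rw [← ρ.proj_toBase, reassoc_of% hxy]
  obtain ⟨U, hU⟩ : ∃ U : Y.AffineZariskiSite, (x ≫ f) pt ∈ U.1 :=
    TopologicalSpace.Opens.mem_iSup.mp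
      ((iSup_affineOpens_eq_top Y).ge (Set.mem_univ ((x ≫ f) pt)))
  -- Both points lie over one affine open subset of `Y`, so they are homomorphisms from the ring of
  -- functions on its inverse image.
  have key : ∀ z : Spec (.of K) ⟶ X, z ≫ f = x ≫ f →
      ∃ α : Γ(X, f ⁻¹ᵁ U.1) →+* K, z = Spec.map (CommRingCat.ofHom α) ≫
        (isAffineOpen_preimage f U).fromSpec := by
    intro z hz
    have hr : Set.range z ⊆ Set.range (isAffineOpen_preimage f U).fromSpec := by
      rw [IsAffineOpen.range_fromSpec]
      rintro _ ⟨p, rfl⟩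
      obtain rfl : p = pt := Subsingleton.elim _ _
      change (z ≫ f) pt ∈ U.1
      rw [hz]
      exact hU
    refine ⟨(Spec.preimage (IsOpenImmersion.lift _ z hr)).hom, ?_⟩
    rw [CommRingCat.ofHom_hom, Spec.map_preimage, IsOpenImmersion.lift_fac]
  obtain ⟨α, hα⟩ := key x rfl
  obtain ⟨β, hβ⟩ := key y hf.symm
  have hS : ∀ s : ρ.invariants U.1, α s.1 = β s.1 := by
    rw [hα, hβ, Category.assoc, Category.assoc, ρ.fromSpec_proj, ← Spec.map_comp_assoc,
      ← Spec.map_comp_assoc, cancel_mono, Spec.map_inj] at hxy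
    exact fun s ↦ congr($hxy s)
  let := ρ.mulSemiringAction U.1
  have : Algebra.IsInvariant (ρ.invariants U.1) Γ(X, f ⁻¹ᵁ U.1) G :=
    ⟨fun c hc ↦ ⟨⟨c, hc⟩, rfl⟩⟩
  have : SMulCommClass G (ρ.invariants U.1) Γ(X, f ⁻¹ᵁ U.1) := ⟨fun g s c ↦ by
    rw [Algebra.smul_def, Algebra.smul_def, smul_mul']
    congr 1
    exact s.2 g⟩
  obtain ⟨g, hg⟩ := exists_comp_smul_eq_of_free_action (ρ.invariants U.1) (G := G)
    Subtype.val_injective (fun g hg ↦ h.span_eq_top g hg U) α β hS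
  refine ⟨g, ?_⟩
  rw [hα, hβ, Category.assoc, ← IsAffineOpen.SpecMap_appLE_fromSpec (ρ.hom g)
    (isAffineOpen_preimage f U) (isAffineOpen_preimage f U) (ρ.preimage_le g U.1),
    ← Spec.map_comp_assoc]
  congr 2
  ext c
  exact hg c

end

end
end AlgebraicGeometry.RelativeAction

/-! ### Descent along étale surjections with transitive deck transformations -/

namespace AlgebraicGeometry

universe u

open Limits

noncomputable section

/-- Every point of a scheme is the image of a point with values in a field. -/
lemma Scheme.exists_field_point (X : Scheme.{u}) (p : X) :
    ∃ (K : Type u) (_ : Field K) (x : Spec (.of K) ⟶ X) (o : Spec (.of K)), x o = p :=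
  ⟨X.residueField p, inferInstance, X.fromSpecResidueField p, IsLocalRing.closedPoint _,
    X.fromSpecResidueField_apply p _⟩

/-- An étale surjection `q : X ⟶ Q` together with a family `t` of endomorphisms of `X` over `Q`
which is transitive on the field-valued points of the fibres of `q`. The endomorphisms need not be
invertible and need not form a group. -/
structure IsGaloisCover {X Q : Scheme.{u}} (q : X ⟶ Q) {I : Type*} (t : I → (X ⟶ X)) : Prop where
  etale : Etale q
  surjective : Surjective q
  comp_eq (i : I) : t i ≫ q = q
  exists_eq_comp (K : Type u) [Field K] (x y : Spec (.of K) ⟶ X) :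
    x ≫ q = y ≫ q → ∃ i, y = x ≫ t i

namespace IsGaloisCover

variable {X Q : Scheme.{u}} {q : X ⟶ Q} {I : Type*} {t : I → (X ⟶ X)}

/-- An invariant morphism equalizes the kernel pair of `q`: the fibre product `X ×_Q X` is covered
by the graphs of the deck transformations, on which the two composites agree. -/
lemma comp_eq_comp (h : IsGaloisCover q t) {Z W : Scheme.{u}} (f : X ⟶ Z)
    (hf : ∀ i, t i ≫ f = f) (a b : W ⟶ X) (hab : a ≫ q = b ≫ q) : a ≫ f = b ≫ f := by
  have := h.etale
  have := h.surjective
  suffices H : pullback.fst q q ≫ f = pullback.snd q q ≫ f by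
    rw [← pullback.lift_fst a b hab, Category.assoc, H, pullback.lift_snd_assoc]
  -- The graphs of the `t i` are sections of the étale map `pullback.fst q q`, hence open
  -- immersions.
  let s (i : I) : X ⟶ pullback q q := pullback.lift (𝟙 X) (t i) (by simp [h.comp_eq])
  have hs (i : I) : s i ≫ pullback.fst q q = 𝟙 X := pullback.lift_fst ..
  have hs' (i : I) : s i ≫ pullback.snd q q = t i := pullback.lift_snd ..
  have (i : I) : IsOpenImmersion (s i) := by
    have : Etale (s i ≫ pullback.fst q q) := by rw [hs]; infer_instance
    have : Etale (s i) := Etale.of_comp (s i) (pullback.fst q q)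
    have : Mono (s i ≫ pullback.fst q q) := by rw [hs]; infer_instance
    have : Mono (s i) := mono_of_mono (s i) (pullback.fst q q)
    exact IsOpenImmersion.of_flat_of_mono (s i)
  let 𝒰 : (pullback q q).OpenCover :=
    { I₀ := I
      X := fun _ ↦ X
      f := s
      mem₀ := by
        rw [Scheme.presieve₀_mem_precoverage_iff]
        refine ⟨fun p ↦ ?_, inferInstance⟩
        obtain ⟨K, _, x, o, rfl⟩ := (pullback q q).exists_field_point p
        obtain ⟨i, hi⟩ := h.exists_eq_comp _ (x ≫ pullback.fst q q) (x ≫ pullback.snd q q)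
          (by rw [Category.assoc, Category.assoc, pullback.condition])
        have hx : x = (x ≫ pullback.fst q q) ≫ s i := by
          apply pullback.hom_ext
          · rw [Category.assoc, hs, Category.comp_id]
          · rw [Category.assoc, hs', hi]
        refine ⟨i, (x ≫ pullback.fst q q) o, ?_⟩
        change s i _ = x o
        rw [← Scheme.Hom.comp_apply, ← hx] }
  refine 𝒰.hom_ext _ _ fun i ↦ ?_
  change s i ≫ _ = s i ≫ _
  rw [reassoc_of% hs, reassoc_of% hs', hf]

/-- A morphism which is invariant under the deck transformations descends. -/
lemma exists_desc (h : IsGaloisCover q t) {Z : Scheme.{u}} (f : X ⟶ Z)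
    (hf : ∀ i, t i ≫ f = f) : ∃ g : Q ⟶ Z, q ≫ g = f := by
  have := h.etale
  have := h.surjective
  exact ⟨EffectiveEpi.desc q f fun a b hab ↦ h.comp_eq_comp f hf a b hab,
    EffectiveEpi.fac q f _⟩

lemma epi (h : IsGaloisCover q t) : Epi q := by
  have := h.etale
  have := h.surjective
  infer_instance

end IsGaloisCover

lemma RelativeAction.IsFree.isGaloisCover {X Y : Scheme.{u}} {f : X ⟶ Y} {G : Type*} [Group G]
    [Finite G] [IsFinite f] [IsLocallyNoetherian Y] {ρ : RelativeAction f G} (h : ρ.IsFree) :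
    IsGaloisCover ρ.proj ρ.hom where
  etale := h.etale_proj
  surjective := inferInstance
  comp_eq := ρ.hom_proj
  exists_eq_comp _ _ x y hxy := h.exists_comp_hom_eq x y hxy

end

end AlgebraicGeometry

/-! ### Unimodular lattices stable under an antisymplectic involution -/

namespace ZLattice

open Module

variable {V : Type*} [NormedAddCommGroup V] [NormedSpace ℝ V]

lemma eq_zero_of_forall_smul_mem_one {W : Type*} [AddCommGroup W] [Module ℝ W] (l : W →ₗ[ℝ] ℝ)
    (x : W) (h : ∀ t : ℝ, l (t • x) ∈ (1 : Submodule ℤ ℝ)) : l x = 0 := by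
  by_contra hx
  -- otherwise some multiple of `x` has the value `1 / 2`
  obtain ⟨n, hn⟩ := Submodule.mem_one.1 (h (1 / (2 * l x)))
  rw [map_smul, smul_eq_mul, algebraMap_int_eq, eq_intCast] at hn
  have : ((2 * n : ℤ) : ℝ) = (1 : ℤ) := by push_cast; rw [hn]; field_simp
  have := Int.cast_injective this
  omega

variable {Λ : Submodule ℤ V} {E : LinearMap.BilinForm ℝ V}

lemma eq_zero_of_forall_mem [DiscreteTopology Λ] [IsZLattice ℝ Λ] (l : V →ₗ[ℝ] ℝ)
    (h : ∀ y ∈ Λ, l y = 0) : l = 0 := by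
  refine LinearMap.ext_on (s := (Λ : Set V)) ?_ fun y hy ↦ h y hy
  exact IsZLattice.span_top

/-- Every integral functional on a lattice is represented by a vector, for a nondegenerate form. -/
lemma exists_eq_of_nondegenerate [FiniteDimensional ℝ V] [DiscreteTopology Λ] [IsZLattice ℝ Λ]
    (hE : E.Nondegenerate) (l : Λ →+ ℤ) : ∃ x, ∀ y : Λ, E x y = l y := by
  have : Module.Free ℤ Λ := ZLattice.module_free ℝ Λ
  have : Module.Finite ℤ Λ := ZLattice.module_finite ℝ Λ
  let b := Module.Free.chooseBasis ℤ Λ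
  let L : V →ₗ[ℝ] ℝ := (b.ofZLatticeBasis ℝ).constr ℝ fun i ↦ (l (b i) : ℝ)
  have hL : ∀ y : Λ, L y = l y := by
    have : (L.restrictScalars ℤ) ∘ₗ Λ.subtype =
        (Algebra.linearMap ℤ ℝ) ∘ₗ l.toIntLinearMap := by
      refine b.ext fun i ↦ ?_
      have := (b.ofZLatticeBasis ℝ).constr_basis ℝ (fun i ↦ (l (b i) : ℝ)) i
      rw [b.ofZLatticeBasis_apply ℝ] at this
      simpa [L] using this
    exact fun y ↦ LinearMap.congr_fun this y
  refine ⟨(E.toDual hE).symm L, fun y ↦ ?_⟩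
  rw [LinearMap.BilinForm.apply_toDual_symm_apply, hL]

/-- A sublattice of the dual of a lattice is discrete. -/
lemma discreteTopology_of_le_dual [FiniteDimensional ℝ V] [DiscreteTopology Λ] [IsZLattice ℝ Λ]
    (hE : E.Nondegenerate) {M : Submodule ℤ V} (hM : M ≤ E.dualSubmodule Λ) :
    DiscreteTopology M := by
  classical
  have : Module.Free ℤ Λ := ZLattice.module_free ℝ Λ
  have : Module.Finite ℤ Λ := ZLattice.module_finite ℝ Λ
  let b := Module.Free.chooseBasis ℤ Λ
  have : DiscreteTopology (E.dualSubmodule Λ) := by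
    rw [← b.ofZLatticeBasis_span ℝ, LinearMap.BilinForm.dualSubmodule_span_of_basis E hE]
    infer_instance
  exact DiscreteTopology.of_subset this hM

/-- The dual of a lattice is spanned by a dual basis. -/
lemma isNoetherian_dual [FiniteDimensional ℝ V] [DiscreteTopology Λ] [IsZLattice ℝ Λ]
    (hE : E.Nondegenerate) :
    IsNoetherian ℤ (E.dualSubmodule Λ) := by
  classical
  have : Module.Free ℤ Λ := ZLattice.module_free ℝ Λ
  have : Module.Finite ℤ Λ := ZLattice.module_finite ℝ Λ
  let b := Module.Free.chooseBasis ℤ Λ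
  rw [← b.ofZLatticeBasis_span ℝ, LinearMap.BilinForm.dualSubmodule_span_of_basis E hE]
  have : Module.Finite ℤ (Submodule.span ℤ (Set.range (E.dualBasis hE (b.ofZLatticeBasis ℝ)))) :=
    Module.Finite.span_of_finite ℤ (Set.finite_range _)
  infer_instance

lemma of_le [DiscreteTopology Λ] [IsZLattice ℝ Λ] {M : Submodule ℤ V} [DiscreteTopology M]
    (h : Λ ≤ M) : IsZLattice ℝ M where
  span_top := top_le_iff.1 (by
    rw [← IsZLattice.span_top (K := ℝ) (L := Λ)]
    exact Submodule.span_mono h)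

/-- A lattice has finite index in any larger lattice. -/
lemma exists_nsmul_mem [FiniteDimensional ℝ V] [DiscreteTopology Λ] [IsZLattice ℝ Λ]
    {M : Submodule ℤ V} [DiscreteTopology M] [IsZLattice ℝ M] (h : Λ ≤ M) :
    ∃ n : ℕ, n ≠ 0 ∧ ∀ x ∈ M, n • x ∈ Λ := by
  have : Module.Free ℤ M := ZLattice.module_free ℝ M
  have : Module.Finite ℤ M := ZLattice.module_finite ℝ M
  have : Finite (M ⧸ Λ.submoduleOf M) := Submodule.finiteQuotientOfFreeOfRankEq _ (by
    rw [(Submodule.submoduleOfEquivOfLe h).finrank_eq, ZLattice.rank ℝ, ZLattice.rank ℝ])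
  refine ⟨Nat.card (M ⧸ Λ.submoduleOf M), Nat.card_pos.ne', fun x hx ↦ ?_⟩
  have h0 : Nat.card (M ⧸ Λ.submoduleOf M) • (Submodule.Quotient.mk ⟨x, hx⟩ : M ⧸ Λ.submoduleOf M)
      = 0 := card_nsmul_eq_zero'
  rw [← Submodule.Quotient.mk_smul, Submodule.Quotient.mk_eq_zero] at h0
  exact h0

/-- The lattices containing `Λ` which are stable under `F` and on which `E` is integral. -/
structure IsAdmissible (Λ : Submodule ℤ V) (E : LinearMap.BilinForm ℝ V) (F : V →ₗ[ℝ] V)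
    (M : Submodule ℤ V) : Prop where
  le : Λ ≤ M
  map_mem : ∀ x ∈ M, F x ∈ M
  le_dual : M ≤ E.dualSubmodule M

variable {F : V →ₗ[ℝ] V}

lemma IsAdmissible.le_dual_left {M : Submodule ℤ V} (hM : IsAdmissible Λ E F M) :
    M ≤ E.dualSubmodule Λ := fun _ hx y hy ↦ hM.le_dual hx y (hM.le hy)

/-- Admissible lattices lie in the dual of `Λ`, which is Noetherian. -/
lemma exists_maximal_isAdmissible [FiniteDimensional ℝ V] [DiscreteTopology Λ] [IsZLattice ℝ Λ]
    (hE : E.Nondegenerate) (h : IsAdmissible Λ E F Λ) : ∃ M, Maximal (IsAdmissible Λ E F) M := by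
  have := isNoetherian_dual (Λ := Λ) hE
  have hw : WellFoundedGT (Submodule ℤ (E.dualSubmodule Λ)) := isNoetherian_iff'.1 this
  obtain ⟨N, hN, hmax⟩ := hw.wf.has_min
    {N | IsAdmissible Λ E F (N.map (E.dualSubmodule Λ).subtype)}
    ⟨Λ.submoduleOf _, by
      rw [Set.mem_ofPred_eq, Submodule.submoduleOf, Submodule.map_comap_subtype,
        inf_eq_right.2 h.le_dual_left]
      exact h⟩
  refine ⟨_, hN, fun M hM hle x hx ↦ ?_⟩
  by_contra hx'
  refine hmax (M.submoduleOf _) ?_ ?_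
  · rw [Set.mem_ofPred_eq, Submodule.submoduleOf, Submodule.map_comap_subtype,
      inf_eq_right.2 hM.le_dual_left]
    exact hM
  · refine lt_of_le_of_ne (fun y hy ↦ hle ⟨y, hy, rfl⟩) fun e ↦ hx' ?_
    rw [e]
    exact ⟨⟨x, hM.le_dual_left hx⟩, hx, rfl⟩

/-- A maximal admissible lattice contains every dual vector `z` with `F z ∈ M + ℤ z`, as `M + ℤ z`
is again admissible. -/
lemma mem_of_maximal (hE : E.IsAlt) {M : Submodule ℤ V} (hM : Maximal (IsAdmissible Λ E F) M)
    {z : V} (hz : z ∈ E.dualSubmodule M) (hF : F z ∈ M ⊔ ℤ ∙ z) : z ∈ M := by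
  refine hM.2 (y := M ⊔ ℤ ∙ z) ⟨hM.1.le.trans le_sup_left, ?_, ?_⟩ le_sup_left
    (Submodule.mem_sup_right (Submodule.mem_span_singleton_self z))
  · intro x hx
    obtain ⟨m, hm, _, ha, rfl⟩ := Submodule.mem_sup.1 hx
    obtain ⟨a, rfl⟩ := Submodule.mem_span_singleton.1 ha
    rw [map_add]
    exact add_mem (Submodule.mem_sup_left (hM.1.map_mem m hm))
      (by rw [map_zsmul]; exact Submodule.smul_mem _ _ hF)
  · intro x hx y hy
    obtain ⟨m, hm, _, ha, rfl⟩ := Submodule.mem_sup.1 hx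
    obtain ⟨a, rfl⟩ := Submodule.mem_span_singleton.1 ha
    obtain ⟨k, hk, _, hb, rfl⟩ := Submodule.mem_sup.1 hy
    obtain ⟨b, rfl⟩ := Submodule.mem_span_singleton.1 hb
    have h1 : E m k ∈ (1 : Submodule ℤ ℝ) := hM.1.le_dual hm k hk
    have h2 : E z k ∈ (1 : Submodule ℤ ℝ) := hz k hk
    have h3 : E m z ∈ (1 : Submodule ℤ ℝ) := by
      rw [← hE.neg_eq]; exact neg_mem (hz m hm)
    have : E (m + a • z) (k + b • z) = E m k + b • E m z + a • E z k := by
      simp only [map_add, map_zsmul, LinearMap.add_apply, LinearMap.smul_apply, hE z]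
      simp
      ring
    rw [this]
    exact add_mem (add_mem h1 (Submodule.smul_mem _ _ h3)) (Submodule.smul_mem _ _ h2)

/-- A maximal admissible lattice is self-dual. For a dual vector `x`, the vector `x + F x` is fixed
by the involution `F`, hence lies in `M`; then `F x ≡ -x` modulo `M` and `x` lies in `M` as well. -/
lemma dual_le_of_maximal (hE : E.IsAlt) (hF : ∀ x, F (F x) = x)
    (hEF : ∀ x y, E (F x) (F y) = - E x y)
    {M : Submodule ℤ V} (hM : Maximal (IsAdmissible Λ E F) M) : E.dualSubmodule M ≤ M := by
  intro x hx
  have hFx : F x ∈ E.dualSubmodule M := fun m hm ↦ by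
    rw [← hF m, hEF]
    exact neg_mem (hx _ (hM.1.map_mem m hm))
  have hy : x + F x ∈ M := mem_of_maximal hE hM (add_mem hx hFx) (by
    rw [map_add, hF, add_comm]
    exact Submodule.mem_sup_right (Submodule.mem_span_singleton_self _))
  refine mem_of_maximal hE hM hx ?_
  rw [← add_sub_cancel_left x (F x)]
  exact sub_mem (Submodule.mem_sup_left hy)
    (Submodule.mem_sup_right (Submodule.mem_span_singleton_self _))

/-- A lattice with an integral alternating nondegenerate form and an antisymplectic involution is
contained in a stable unimodular lattice. -/
theorem exists_unimodular [FiniteDimensional ℝ V] [DiscreteTopology Λ] [IsZLattice ℝ Λ]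
    (hE : E.IsAlt) (hnd : E.Nondegenerate) (hF : ∀ x, F (F x) = x)
    (hEF : ∀ x y, E (F x) (F y) = - E x y)
    (h : IsAdmissible Λ E F Λ) :
    ∃ (M : Submodule ℤ V) (_ : DiscreteTopology M), IsZLattice ℝ M ∧ IsAdmissible Λ E F M ∧
      (∃ n : ℕ, n ≠ 0 ∧ ∀ x ∈ M, n • x ∈ Λ) ∧
      ∀ l : M →+ ℤ, ∃! x : M, ∀ y : M, E x y = l y := by
  obtain ⟨M, hM⟩ := exists_maximal_isAdmissible hnd h
  have hd : DiscreteTopology M := discreteTopology_of_le_dual hnd hM.1.le_dual_left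
  have hz : IsZLattice ℝ M := of_le hM.1.le
  refine ⟨M, hd, hz, hM.1, exists_nsmul_mem hM.1.le, fun l ↦ ?_⟩
  obtain ⟨x, hx⟩ := exists_eq_of_nondegenerate hnd l
  have hxM : x ∈ M := dual_le_of_maximal hE hF hEF hM fun y hy ↦
    Submodule.mem_one.2 ⟨l ⟨y, hy⟩, (hx ⟨y, hy⟩).symm⟩
  refine ⟨⟨x, hxM⟩, hx, fun x' hx' ↦ Subtype.ext ?_⟩
  have h0 : E (x' - x) = 0 := eq_zero_of_forall_mem (Λ := M) _ fun y hy ↦ by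
    rw [map_sub, LinearMap.sub_apply, sub_eq_zero]
    exact (hx' ⟨y, hy⟩).trans (hx ⟨y, hy⟩).symm
  exact sub_eq_zero.1 (hnd.1 _ fun y ↦ by rw [h0]; rfl)

end ZLattice

/-! ### Finiteness from finite fibres on points, and descent of reducedness -/

namespace AlgebraicGeometry

universe u

open Limits

/-- A morphism between proper schemes over an algebraically closed field is finite if it has
finitely many rational points over every rational point. The locus of quasi-finiteness is open by
Zariski's Main Theorem, so it suffices that it contains the closed points; the fibre over a closed
point has finitely many closed points, hence is discrete. -/
lemma isFinite_of_finite_points {K : Type u} [Field K] [IsAlgClosed K] {X Y : Scheme.{u}}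
    (h : X ⟶ Y) (i : Y ⟶ Spec (.of K)) [IsSeparated i] [LocallyOfFiniteType i] [IsProper (h ≫ i)]
    (hfin : ∀ y : Spec (.of K) ⟶ Y, y ≫ i = 𝟙 _ → {x : Spec (.of K) ⟶ X | x ≫ h = y}.Finite) :
    IsFinite h := by
  have : IsProper h := IsProper.of_comp h i
  have : JacobsonSpace X := LocallyOfFiniteType.jacobsonSpace (h ≫ i)
  suffices h.quasiFiniteLocus = ⊤ by
    have := h.quasiFiniteLocus_eq_top_iff.1 this
    exact IsFinite.of_isProper_of_locallyQuasiFinite h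
  by_contra hne
  obtain ⟨x, hx, hxc⟩ : ((h.quasiFiniteLocus : Set X)ᶜ ∩ closedPoints X).Nonempty := by
    refine nonempty_inter_closedPoints ?_ h.quasiFiniteLocus.isOpen.isClosed_compl.isLocallyClosed
    rw [Set.nonempty_compl]
    exact fun e ↦ hne (SetLike.coe_injective e)
  have hyc : IsClosed {h x} := by
    simpa using h.isClosedMap _ hxc
  have hF : IsClosed (h ⁻¹' {h x}) := hyc.preimage h.continuous
  have hfin' : (h ⁻¹' {h x} ∩ closedPoints X).Finite := by
    refine ((hfin (pointOfClosedPoint i (h x) hyc) (pointOfClosedPoint_comp ..)).image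
      fun p ↦ p (IsLocalRing.closedPoint K)).subset ?_
    rintro z ⟨hz, hzc⟩
    replace hzc : IsClosed {z} := hzc
    refine ⟨pointOfClosedPoint (h ≫ i) z hzc, ?_, pointOfClosedPoint_apply ..⟩
    refine ext_of_apply_closedPoint_eq i ?_ ?_ ?_
    · rw [Category.assoc, pointOfClosedPoint_comp]
    · rw [pointOfClosedPoint_comp]
    · exact (congrArg h (pointOfClosedPoint_apply ..)).trans
        (Eq.trans hz (pointOfClosedPoint_apply ..).symm)
  have hsub : h ⁻¹' {h x} ⊆ closedPoints X := by
    rw [← hF.closure_eq, ← JacobsonSpace.closure_inter_closedPoints_eq_closure hF.isLocallyClosed,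
      IsClosed.closure_eq]
    · exact Set.inter_subset_right
    · rw [← Set.biUnion_of_singleton (h ⁻¹' {h x} ∩ closedPoints X)]
      exact hfin'.isClosed_biUnion fun z hz ↦ hz.2
  have hd : _root_.IsDiscrete (h ⁻¹' {h x}) := by
    rw [Set.inter_eq_left.2 hsub] at hfin'
    exact hfin'.isDiscrete_of_subset_closedPoints hsub
  refine hx ?_
  change h.QuasiFiniteAt x
  rw [Scheme.Hom.quasiFiniteAt_iff_isOpen_singleton_asFiber]
  have := hd.to_subtype
  have : DiscreteTopology (h.fiber (h x)) := (h.fiberHomeo (h x)).isEmbedding.discreteTopology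
  exact isOpen_discrete _

lemma isReduced_of_flat_of_surjective {X Y : Scheme.{u}} (f : X ⟶ Y) [Flat f] [Surjective f]
    [AlgebraicGeometry.IsReduced X] : AlgebraicGeometry.IsReduced Y := by
  have (y : Y) : _root_.IsReduced (Y.presheaf.stalk y) := by
    obtain ⟨x, rfl⟩ := f.surjective y
    algebraize [(f.stalkMap x).hom]
    have : Module.FaithfullyFlat (Y.presheaf.stalk (f x)) (X.presheaf.stalk x) :=
      @Module.FaithfullyFlat.of_flat_of_isLocalHom _ _ _ _ _ _ _
        (Flat.stalkMap f x) (f.toLRSHom.prop x)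
    exact isReduced_of_injective _ ‹RingHom.FaithfullyFlat _›.injective
  exact isReduced_of_isReduced_stalk Y

/-- Flat morphisms with geometrically reduced fibres preserve reducedness of locally Noetherian
schemes, in particular of the base changes of `Y` to fields. -/
lemma GeometricallyReduced.comp_of_flat {X Y Z : Scheme.{u}} (f : X ⟶ Y) (g : Y ⟶ Z)
    [GeometricallyReduced f] [Flat f] [GeometricallyReduced g] [LocallyOfFiniteType g] :
    GeometricallyReduced (f ≫ g) := by
  refine ⟨fun K _ y W p q h ↦ ?_⟩
  have hr : AlgebraicGeometry.IsReduced (pullback g y) :=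
    GeometricallyReduced.geometrically_isReduced (f := g) y _ _ (IsPullback.of_hasPullback g y)
  have : IsLocallyNoetherian (pullback g y) :=
    LocallyOfFiniteType.isLocallyNoetherian (pullback.snd g y)
  have hp : IsPullback p (pullback.lift (p ≫ f) q (by rw [Category.assoc, h.w])) f
      (pullback.fst g y) := by
    refine (IsPullback.of_right ?_ (by rw [pullback.lift_fst])
      (IsPullback.of_hasPullback g y).flip).flip
    rw [pullback.lift_snd]
    exact h.flip
  have : GeometricallyReduced (pullback.lift (p ≫ f) q (by rw [Category.assoc, h.w])) :=
    MorphismProperty.of_isPullback hp ‹_›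
  have : Flat (pullback.lift (p ≫ f) q (by rw [Category.assoc, h.w])) :=
    MorphismProperty.of_isPullback hp ‹_›
  exact GeometricallyReduced.isReduced_of_flat_of_isLocallyNoetherian
    (pullback.lift (p ≫ f) q (by rw [Category.assoc, h.w]))

/-- A finite separable extension of fields is geometrically reduced. -/
lemma geometricallyReduced_SpecMap_algebraMap (k L : Type u) [Field k] [Field L] [Algebra k L]
    [FiniteDimensional k L] [Algebra.IsSeparable k L] :
    GeometricallyReduced (Spec.map (CommRingCat.ofHom (algebraMap k L))) := by
  refine ⟨fun K _ y W p q h ↦ ?_⟩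
  obtain ⟨φ, rfl⟩ := Spec.map_surjective y
  algebraize [φ.hom]
  have hT := isPullback_SpecMap_of_isPushout _ _ _ _ (CommRingCat.isPushout_tensorProduct k L K)
  have e : W ≅ Spec (.of (TensorProduct k L K)) := h.isoIsPullback _ _ hT
  have : Algebra.FormallyUnramified k L := Algebra.FormallyUnramified.of_isSeparable k L
  have : _root_.IsReduced (TensorProduct k K L) :=
    Algebra.FormallyUnramified.isReduced_of_field K (TensorProduct k K L)
  have : _root_.IsReduced (TensorProduct k L K) :=
    isReduced_of_injective (Algebra.TensorProduct.comm k L K) (AlgEquiv.injective _)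
  exact isReduced_of_isOpenImmersion e.hom

end AlgebraicGeometry

/-! ### The action of a finite group of complex points -/

noncomputable section

namespace RealAbelianVariety

open Limits MonoidalCategory CartesianMonoidalCategory

/-- A morphism between spectra of fields is flat and surjective, hence an epimorphism. -/
lemma epi_of_field {S : Scheme.{0}} {K L : Type} [Field K] [Field L] {T : Over S}
    (hT : T.left = Spec (.of K)) (a : Spec (.of L) ⟶ S) (z : T ⟶ Over.mk a) : Epi z := by
  obtain ⟨T, _, t⟩ := T
  change T = _ at hT
  subst hT
  have : Subsingleton (Over.mk a).left := inferInstanceAs (Subsingleton (Spec (.of L)))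
  have : Surjective z.left := ⟨fun y ↦ ⟨IsLocalRing.closedPoint K, Subsingleton.elim _ _⟩⟩
  have : Flat z.left := by
    have : AlgebraicGeometry.IsIntegral (Over.mk a).left :=
      inferInstanceAs (AlgebraicGeometry.IsIntegral (Spec (.of L)))
    infer_instance
  have : Epi z.left := Flat.epi_of_flat_of_surjective _
  exact Over.epi_of_epi_left z

/-- The action of the Galois group of `ℂ` over `ℝ` on `Spec ℂ`. -/
def specGal (s : ℂ ≃ₐ[ℝ] ℂ) : specComplex ⟶ specComplex :=
  Over.homMk (Spec.map (CommRingCat.ofHom (s : ℂ →+* ℂ))) (by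
    simp only [specComplex, Over.mk_hom, ← Spec.map_comp, ← CommRingCat.ofHom_comp]
    congr 2
    ext r
    exact s.commutes r)

lemma specGal_left (s : ℂ ≃ₐ[ℝ] ℂ) :
    (specGal s).left = Spec.map (CommRingCat.ofHom (s : ℂ →+* ℂ)) := rfl

lemma specGal_one : specGal 1 = 𝟙 _ := by
  ext1
  exact Spec.map_id _

lemma specGal_mul (s t : ℂ ≃ₐ[ℝ] ℂ) : specGal (s * t) = specGal s ≫ specGal t := by
  ext1
  rw [Over.comp_left, specGal_left, specGal_left, specGal_left, ← Spec.map_comp]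
  rfl

lemma specGal_eq_id_or_conj (s : ℂ ≃ₐ[ℝ] ℂ) : specGal s = 𝟙 _ ∨ specGal s = specConj := by
  rcases Complex.real_algHom_eq_id_or_conj s.toAlgHom with h | h
  · left
    rw [← specGal_one]
    congr 1
    ext1 x
    exact DFunLike.congr_fun h x
  · right
    ext1
    refine congrArg (fun f ↦ Spec.map (CommRingCat.ofHom f)) ?_
    ext1 x
    exact DFunLike.congr_fun h x

lemma specGal_injective : Function.Injective specGal := fun s t h ↦ by
  have h' := congrArg (fun f ↦ f.left) h
  rw [specGal_left, specGal_left, Spec.map_inj] at h'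
  ext1 x
  exact congr($h' x)

variable {A : RealAbelianVariety}

/-- The rigidity theorem: an abelian variety is commutative. -/
instance : IsCommMonObj A.X := isCommMonObj_of_isProper_of_geometricallyIntegral A.X

/-- A group of complex points of `A` which is stable under the Galois group and contained in the
group of `exponent`-torsion points, the latter being finite. -/
structure GaloisSubgroup (A : RealAbelianVariety) where
  /-- the group of complex points -/
  toSubgroup : Subgroup A.ComplexPoint
  specGal_comp_mem (s : ℂ ≃ₐ[ℝ] ℂ) {p : A.ComplexPoint} (hp : p ∈ toSubgroup) :
    specGal s ≫ p ∈ toSubgroup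
  /-- an exponent of the group -/
  exponent : ℕ
  pow_exponent {p : A.ComplexPoint} (hp : p ∈ toSubgroup) : p ^ exponent = 1
  finite_torsion : {p : A.ComplexPoint | p ^ exponent = 1}.Finite

namespace GaloisSubgroup

variable (H : GaloisSubgroup A)

/-- The action of the Galois group on the group of complex points. -/
def galAction : (ℂ ≃ₐ[ℝ] ℂ) →* MulAut H.toSubgroup where
  toFun s :=
    { toFun := fun p ↦ ⟨specGal s ≫ p.1, H.specGal_comp_mem s p.2⟩
      invFun := fun p ↦ ⟨specGal s⁻¹ ≫ p.1, H.specGal_comp_mem _ p.2⟩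
      left_inv := fun p ↦ Subtype.ext (by
        dsimp only
        rw [← Category.assoc, ← specGal_mul, inv_mul_cancel, specGal_one, Category.id_comp])
      right_inv := fun p ↦ Subtype.ext (by
        dsimp only
        rw [← Category.assoc, ← specGal_mul, mul_inv_cancel, specGal_one, Category.id_comp])
      map_mul' := fun p q ↦ Subtype.ext (MonObj.comp_mul _ _ _) }
  map_one' :=
    MulEquiv.ext fun p ↦ Subtype.ext
      ((congrArg (fun f ↦ f ≫ p.1) specGal_one).trans (Category.id_comp _))
  map_mul' s t :=
    MulEquiv.ext fun p ↦ Subtype.ext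
      ((congrArg (fun f ↦ f ≫ p.1) (specGal_mul s t)).trans (Category.assoc _ _ _))

/-- The extension of the Galois group by the group of complex points which acts on
`A ×_ℝ Spec ℂ`. -/
abbrev DeckGroup : Type := H.toSubgroup ⋊[H.galAction] (ℂ ≃ₐ[ℝ] ℂ)

instance : Finite H.DeckGroup :=
  have : Finite H.toSubgroup := H.finite_torsion.subset fun _ ↦ H.pow_exponent
  Finite.of_equiv _ SemidirectProduct.equivProd.symm

/-- The action of the deck group on `A ×_ℝ Spec ℂ`: the element `(p, s)` sends `(a, z)` to
`(a + p(z), s(z))`. -/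
def deck (g : H.DeckGroup) : A.X ⊗ specComplex ⟶ A.X ⊗ specComplex :=
  lift (fst _ _ * snd _ _ ≫ g.left.1) (snd _ _ ≫ specGal g.right)

lemma deck_fst (g : H.DeckGroup) : H.deck g ≫ fst _ _ = fst _ _ * snd _ _ ≫ g.left.1 :=
  lift_fst _ _

lemma deck_snd (g : H.DeckGroup) : H.deck g ≫ snd _ _ = snd _ _ ≫ specGal g.right :=
  lift_snd _ _

lemma deck_one : H.deck 1 = 𝟙 _ := by
  apply CartesianMonoidalCategory.hom_ext
  · rw [deck_fst, Category.id_comp]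
    refine (congrArg (fst _ _ * ·) ?_).trans (mul_one _)
    exact MonObj.comp_one _
  · rw [deck_snd, SemidirectProduct.one_right, specGal_one, Category.comp_id, Category.id_comp]

lemma deck_mul (g h : H.DeckGroup) : H.deck (g * h) = H.deck g ≫ H.deck h := by
  apply CartesianMonoidalCategory.hom_ext
  · rw [deck_fst, Category.assoc, deck_fst, MonObj.comp_mul, deck_fst, ← Category.assoc (H.deck g),
      deck_snd, mul_assoc, Category.assoc, ← MonObj.comp_mul]
    rfl
  · rw [deck_snd, Category.assoc, deck_snd, ← Category.assoc, deck_snd,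
      SemidirectProduct.mul_right, specGal_mul, Category.assoc]

lemma deck_pow (g : H.DeckGroup) :
    H.deck g ≫ fst _ _ ^ H.exponent = fst _ _ ^ H.exponent := by
  rw [MonObj.comp_pow, deck_fst, mul_pow, ← MonObj.comp_pow, H.pow_exponent g.left.2,
    MonObj.comp_one, mul_one]

/-- The action of the deck group on `A ×_ℝ Spec ℂ`, relative to multiplication by the
exponent on `A`. -/
def action : RelativeAction (fst A.X specComplex ^ H.exponent : _ ⟶ A.X).left H.DeckGroup where
  hom g := (H.deck g).left
  hom_one := by rw [deck_one, Over.id_left]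
  hom_mul g h := by rw [deck_mul, Over.comp_left]
  hom_comp g := by rw [← Over.comp_left, H.deck_pow]

/-- A fixed point `x` with values in a field projects to an epimorphism onto `Spec ℂ`. Hence an
element which fixes `x` acts trivially on `Spec ℂ`, and translates by the trivial point. -/
lemma isFree_action : H.action.IsFree := by
  intro g K _ x hx
  let T : Over (Spec (.of ℝ)) := Over.mk (x ≫ (A.X ⊗ specComplex).hom)
  let y : T ⟶ A.X ⊗ specComplex := Over.homMk x
  have hy : y ≫ H.deck g = y := Over.OverMorphism.ext hx
  have hepi : Epi (y ≫ snd _ _) := epi_of_field (K := K) rfl _ _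
  have hright : g.right = 1 := by
    apply specGal_injective
    rw [specGal_one, ← cancel_epi (y ≫ snd _ _), Category.comp_id, Category.assoc, ← H.deck_snd,
      reassoc_of% hy]
  have hleft : g.left = 1 := by
    apply Subtype.ext
    rw [← cancel_epi (y ≫ snd _ _)]
    refine Eq.trans ?_ (MonObj.comp_one _).symm
    have := congrArg (· ≫ fst _ _) hy
    simp only [Category.assoc, deck_fst, MonObj.comp_mul, mul_eq_left] at this
    rw [Category.assoc]
    exact this
  exact SemidirectProduct.ext hleft hright

end GaloisSubgroup

end RealAbelianVariety

end

/-! ### The quotient of an abelian variety by a finite group of complex points -/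

noncomputable section

namespace RealAbelianVariety

open Limits MonoidalCategory CartesianMonoidalCategory

variable {A : RealAbelianVariety}

instance : IsFinite specComplex.hom := by
  refine (IsFinite.SpecMap_iff _).2 ?_
  rw [CommRingCat.hom_ofHom, RingHom.finite_algebraMap]
  infer_instance

instance isFinite_fst : IsFinite (fst A.X specComplex).left :=
  inferInstanceAs (IsFinite (pullback.fst A.X.hom specComplex.hom))

instance isProper_snd : IsProper (snd A.X specComplex).left :=
  inferInstanceAs (IsProper (pullback.snd A.X.hom specComplex.hom))

lemma finite_setOf_pow_eq {G : Type*} [CommGroup G] {n : ℕ} (h : {p : G | p ^ n = 1}.Finite)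
    (c : G) : {p : G | p ^ n = c}.Finite := by
  by_cases hc : ∃ a : G, a ^ n = c
  · obtain ⟨a, rfl⟩ := hc
    refine (h.image (a * ·)).subset fun p hp ↦ ⟨a⁻¹ * p, ?_, mul_inv_cancel_left a p⟩
    rw [Set.mem_ofPred_eq, mul_pow, hp, inv_pow, inv_mul_cancel]
  · convert Set.finite_empty
    exact Set.eq_empty_of_forall_notMem fun p hp ↦ hc ⟨p, hp⟩

/-- The morphism `(a, z) ↦ n a` from `A ×_ℝ Spec ℂ` to `A` is finite if the `n`-torsion of `A(ℂ)` is
finite: it is the composition of multiplication by `n` on `A ×_ℝ Spec ℂ`, which is finite by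
`isFinite_of_finite_points`, and of the finite projection to `A`. The group law of `A` is written
multiplicatively. -/
lemma isFinite_pow {n : ℕ} (hfin : {p : A.ComplexPoint | p ^ n = 1}.Finite) :
    IsFinite (fst A.X specComplex ^ n : _ ⟶ A.X).left := by
  let h : A.X ⊗ specComplex ⟶ A.X ⊗ specComplex := lift (fst _ _ ^ n) (snd _ _)
  have hf : h ≫ fst _ _ = fst _ _ ^ n := lift_fst _ _
  have hs : h.left ≫ (snd A.X specComplex).left = (snd A.X specComplex).left := by
    rw [← Over.comp_left, lift_snd]
  have : IsFinite h.left := by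
    have : IsProper (h.left ≫ (snd A.X specComplex).left) := by rw [hs]; infer_instance
    refine isFinite_of_finite_points (K := ℂ) h.left (snd A.X specComplex).left fun y hy ↦ ?_
    let y' : specComplex ⟶ A.X ⊗ specComplex := Over.homMk y (by
      rw [← Over.w (snd A.X specComplex), reassoc_of% hy])
    refine ((finite_setOf_pow_eq hfin (y' ≫ fst _ _)).image
      fun p ↦ (lift p (𝟙 specComplex)).left).subset fun x hx ↦ ?_
    have hx1 : x ≫ (snd A.X specComplex).left = 𝟙 _ := by
      rw [← hs, ← Category.assoc, hx, hy]
      rfl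
    let x' : specComplex ⟶ A.X ⊗ specComplex := Over.homMk x (by
      rw [← Over.w (snd A.X specComplex), reassoc_of% hx1])
    have hx2 : x' ≫ h = y' := Over.OverMorphism.ext hx
    refine ⟨x' ≫ fst _ _, ?_, ?_⟩
    · rw [Set.mem_ofPred_eq, ← MonObj.comp_pow, ← hf, ← hx2, Category.assoc]
    · suffices lift (x' ≫ fst _ _) (𝟙 specComplex) = x' from congrArg (·.left) this
      apply CartesianMonoidalCategory.hom_ext
      · rw [lift_fst]
      · rw [lift_snd]
        exact Over.OverMorphism.ext hx1.symm
  rw [← hf, Over.comp_left]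
  infer_instance

instance : Surjective (fst A.X specComplex).left := by
  have : Surjective specComplex.hom := by
    have : Subsingleton (Spec (.of ℝ)) := inferInstance
    exact ⟨fun y ↦ ⟨IsLocalRing.closedPoint ℂ, Subsingleton.elim _ _⟩⟩
  exact inferInstanceAs (Surjective (pullback.fst A.X.hom specComplex.hom))

instance : Flat (fst A.X specComplex).left :=
  have : Flat specComplex.hom := inferInstance
  inferInstanceAs (Flat (pullback.fst A.X.hom specComplex.hom))

instance : Epi (fst A.X specComplex) :=
  have : Epi (fst A.X specComplex).left := Flat.epi_of_flat_of_surjective _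
  Over.epi_of_epi_left _

instance : IsLocallyNoetherian A.X.left := LocallyOfFiniteType.isLocallyNoetherian A.X.hom

instance : Etale (fst A.X specComplex).left := by
  have : Algebra.FormallyEtale ℝ ℂ := Algebra.FormallyEtale.of_isSeparable ℝ ℂ
  have : Algebra.FinitePresentation ℝ ℂ := Algebra.FinitePresentation.of_finiteType.1 inferInstance
  have : Algebra.Etale ℝ ℂ := ⟨‹_›, ‹_›⟩
  have : Etale specComplex.hom :=
    (HasRingHomProperty.Spec_iff (P := @Etale)).2 (RingHom.etale_algebraMap.2 ‹_›)
  exact inferInstanceAs (Etale (pullback.fst A.X.hom specComplex.hom))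

/-- Two complex embeddings in a field which agree on the real numbers are conjugate. -/
lemma exists_eq_comp_algEquiv {K : Type*} [Field K] (α β : ℂ →+* K)
    (h : ∀ r : ℝ, α r = β r) : ∃ s : ℂ ≃ₐ[ℝ] ℂ, β = α.comp s := by
  have hI : β Complex.I = α Complex.I ∨ β Complex.I = -α Complex.I := by
    rw [← sq_eq_sq_iff_eq_or_eq_neg, ← map_pow, ← map_pow, Complex.I_sq]
    simp
  have key (s : ℂ ≃ₐ[ℝ] ℂ) (hs : β Complex.I = α (s Complex.I)) : β = α.comp s := by
    ext z
    have hr (r : ℝ) : s r = r := s.commutes r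
    rw [← Complex.re_add_im z, RingHom.comp_apply, RingHom.coe_coe]
    simp only [map_add, map_mul, hs, hr, h]
  rcases hI with hI | hI
  · exact ⟨1, key _ hI⟩
  · exact ⟨Complex.conjAe, key _ (by simp [hI])⟩

lemma isGaloisCover_fst : IsGaloisCover (fst A.X specComplex).left
    fun s : ℂ ≃ₐ[ℝ] ℂ ↦ (lift (fst A.X specComplex) (snd _ _ ≫ specGal s)).left where
  etale := inferInstance
  surjective := inferInstance
  comp_eq s := by rw [← Over.comp_left, lift_fst]
  exists_eq_comp K _ x y hxy := by
    have hX : x ≫ (A.X ⊗ specComplex).hom = y ≫ (A.X ⊗ specComplex).hom := by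
      rw [← Over.w (fst A.X specComplex), reassoc_of% hxy]
    let x' : Over.mk (x ≫ (A.X ⊗ specComplex).hom) ⟶ A.X ⊗ specComplex := Over.homMk x
    let y' : Over.mk (x ≫ (A.X ⊗ specComplex).hom) ⟶ A.X ⊗ specComplex := Over.homMk y hX.symm
    obtain ⟨a, ha⟩ := Spec.map_surjective (R := .of ℂ) (S := .of K) (x' ≫ snd _ _).left
    obtain ⟨b, hb⟩ := Spec.map_surjective (R := .of ℂ) (S := .of K) (y' ≫ snd _ _).left
    obtain ⟨s, hs⟩ := exists_eq_comp_algEquiv a.hom b.hom fun r ↦ by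
      have h : Spec.map a ≫ specComplex.hom = Spec.map b ≫ specComplex.hom := by
        rw [ha, hb]
        exact (Over.w (x' ≫ snd _ _)).trans (Over.w (y' ≫ snd _ _)).symm
      replace h := (Spec.map_comp _ _).trans (h.trans (Spec.map_comp _ _).symm)
      rw [Spec.map_inj] at h
      exact congr($h r)
    refine ⟨s, ?_⟩
    suffices y' = x' ≫ lift (fst A.X specComplex) (snd _ _ ≫ specGal s) from
      congrArg (·.left) this
    apply CartesianMonoidalCategory.hom_ext
    · rw [Category.assoc, lift_fst]
      exact Over.OverMorphism.ext hxy.symm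
    · rw [Category.assoc, lift_snd]
      apply Over.OverMorphism.ext
      rw [← Category.assoc]
      refine hb.symm.trans (Eq.trans ?_ (congrArg (· ≫ (specGal s).left) ha))
      refine Eq.trans ?_ (Spec.map_comp _ _)
      congr 1
      ext1
      exact hs

end RealAbelianVariety

end

/-! ### Group structure and isogeny -/

noncomputable section

namespace AlgebraicGeometry.IsGaloisCover

universe u

open Limits MonoidalCategory CartesianMonoidalCategory

variable {S : Scheme.{u}} {X Q : Over S} {q : X ⟶ Q} {I : Type*} {t : I → (X ⟶ X)}

/-- Descent along a Galois cover in the category of schemes over a base. -/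
lemma exists_over_desc (h : IsGaloisCover q.left fun i ↦ (t i).left) {Z : Over S} (f : X ⟶ Z)
    (hf : ∀ i, t i ≫ f = f) : ∃ g : Q ⟶ Z, q ≫ g = f := by
  obtain ⟨g, hg⟩ := h.exists_desc f.left fun i ↦ by rw [← Over.comp_left, hf]
  have := h.epi
  refine ⟨Over.homMk g ?_, Over.OverMorphism.ext hg⟩
  rw [← cancel_epi q.left, reassoc_of% hg, Over.w, Over.w]

lemma over_epi (h : IsGaloisCover q.left fun i ↦ (t i).left) : Epi q :=
  have := h.epi
  Over.epi_of_epi_left _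

lemma tensorHom (h : IsGaloisCover q.left fun i ↦ (t i).left) {X' Q' : Over S} {q' : X' ⟶ Q'}
    {I' : Type*} {t' : I' → (X' ⟶ X')} (h' : IsGaloisCover q'.left fun i ↦ (t' i).left) :
    IsGaloisCover (q ⊗ₘ q').left fun i : I × I' ↦ (t i.1 ⊗ₘ t' i.2).left where
  etale := by
    rw [Over.tensorHom_left]
    have : MorphismProperty.IsStableUnderComposition (@Etale.{u}) :=
      ⟨fun _ _ _ _ ↦ inferInstance⟩
    exact MorphismProperty.pullbackMap (P := @Etale) h.etale h'.etale (Over.w q).symm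
      (Over.w q').symm
  surjective := by
    rw [Over.tensorHom_left]
    have : MorphismProperty.IsStableUnderComposition (@Surjective.{u}) :=
      ⟨fun _ _ _ _ ↦ inferInstance⟩
    exact MorphismProperty.pullbackMap (P := @Surjective) h.surjective h'.surjective
      (Over.w q).symm (Over.w q').symm
  comp_eq i := by
    rw [← Over.comp_left, tensorHom_comp_tensorHom]
    congr 2
    · exact Over.OverMorphism.ext (h.comp_eq i.1)
    · exact Over.OverMorphism.ext (h'.comp_eq i.2)
  exists_eq_comp K _ x y hxy := by
    have hX : x ≫ (X ⊗ X').hom = y ≫ (X ⊗ X').hom := by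
      rw [← Over.w (q ⊗ₘ q'), reassoc_of% hxy]
    let x' : Over.mk (x ≫ (X ⊗ X').hom) ⟶ X ⊗ X' := Over.homMk x
    let y' : Over.mk (x ≫ (X ⊗ X').hom) ⟶ X ⊗ X' := Over.homMk y hX.symm
    have hxy' : x' ≫ (q ⊗ₘ q') = y' ≫ (q ⊗ₘ q') := Over.OverMorphism.ext hxy
    obtain ⟨i, hi⟩ := h.exists_eq_comp K (x' ≫ fst _ _).left (y' ≫ fst _ _).left (by
      have := congrArg (· ≫ fst _ _) hxy'
      simp only [Category.assoc, tensorHom_fst] at this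
      simpa using! congrArg (·.left) this)
    obtain ⟨j, hj⟩ := h'.exists_eq_comp K (x' ≫ snd _ _).left (y' ≫ snd _ _).left (by
      have := congrArg (· ≫ snd _ _) hxy'
      simp only [Category.assoc, tensorHom_snd] at this
      simpa using! congrArg (·.left) this)
    refine ⟨(i, j), ?_⟩
    suffices y' = x' ≫ (t i ⊗ₘ t' j) from congrArg (·.left) this
    apply CartesianMonoidalCategory.hom_ext
    · rw [Category.assoc, tensorHom_fst, ← Category.assoc]
      exact Over.OverMorphism.ext hi
    · rw [Category.assoc, tensorHom_snd, ← Category.assoc]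
      exact Over.OverMorphism.ext hj

end AlgebraicGeometry.IsGaloisCover

namespace RealAbelianVariety

open Limits MonoidalCategory CartesianMonoidalCategory

/-- A group structure descends along a morphism whose tensor powers are epimorphisms. -/
abbrev _root_.CategoryTheory.GrpObj.ofEpi {C : Type*} [Category C] [CartesianMonoidalCategory C]
    {X Y : C} [GrpObj X] (φ : X ⟶ Y) [Epi φ] [Epi (φ ⊗ₘ φ)] [Epi ((φ ⊗ₘ φ) ⊗ₘ φ)] (m : Y ⊗ Y ⟶ Y)
    (hm : (φ ⊗ₘ φ) ≫ m = MonObj.mul ≫ φ) (i : Y ⟶ Y) (hi : φ ≫ i = GrpObj.inv ≫ φ) :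
    GrpObj Y where
  one := MonObj.one ≫ φ
  mul := m
  inv := i
  one_mul := by
    have : Epi (𝟙_ C ◁ φ) := by
      have h : 𝟙_ C ◁ φ = (λ_ X).hom ≫ φ ≫ (λ_ Y).inv := by simp
      rw [h]
      infer_instance
    rw [← cancel_epi (𝟙_ C ◁ φ), leftUnitor_naturality, ← MonObj.one_mul, Category.assoc, ← hm,
      ← Category.assoc, ← Category.assoc, ← id_tensorHom, ← tensorHom_id, ← tensorHom_id,
      tensorHom_comp_tensorHom, tensorHom_comp_tensorHom, Category.id_comp, Category.comp_id,
      Category.id_comp]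
  mul_one := by
    have : Epi (φ ▷ 𝟙_ C) := by
      have h : φ ▷ 𝟙_ C = (ρ_ X).hom ≫ φ ≫ (ρ_ Y).inv := by simp
      rw [h]
      infer_instance
    rw [← cancel_epi (φ ▷ 𝟙_ C), rightUnitor_naturality, ← MonObj.mul_one, Category.assoc, ← hm,
      ← Category.assoc, ← Category.assoc, ← id_tensorHom, ← tensorHom_id, ← id_tensorHom,
      tensorHom_comp_tensorHom, tensorHom_comp_tensorHom, Category.id_comp, Category.comp_id,
      Category.id_comp]
  mul_assoc := by
    rw [← cancel_epi ((φ ⊗ₘ φ) ⊗ₘ φ)]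
    have h₁ : ((φ ⊗ₘ φ) ⊗ₘ φ) ≫ m ▷ Y = MonObj.mul ▷ X ≫ (φ ⊗ₘ φ) := by
      rw [← tensorHom_id, tensorHom_comp_tensorHom, hm, ← tensorHom_id, tensorHom_comp_tensorHom,
        Category.comp_id, Category.id_comp]
    have h₂ : (φ ⊗ₘ φ ⊗ₘ φ) ≫ Y ◁ m = X ◁ MonObj.mul ≫ (φ ⊗ₘ φ) := by
      rw [← id_tensorHom, tensorHom_comp_tensorHom, hm, ← id_tensorHom, tensorHom_comp_tensorHom,
        Category.comp_id, Category.id_comp]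
    rw [reassoc_of% h₁, hm, associator_naturality_assoc, reassoc_of% h₂, hm,
      MonObj.mul_assoc_assoc]
  left_inv := by
    have h : φ ≫ lift i (𝟙 Y) = lift GrpObj.inv (𝟙 X) ≫ (φ ⊗ₘ φ) := by
      rw [comp_lift, hi, lift_map, Category.comp_id, Category.id_comp]
    rw [← cancel_epi φ, reassoc_of% h, hm, GrpObj.left_inv_assoc, comp_toUnit_assoc]
  right_inv := by
    have h : φ ≫ lift (𝟙 Y) i = lift (𝟙 X) GrpObj.inv ≫ (φ ⊗ₘ φ) := by
      rw [comp_lift, hi, lift_map, Category.comp_id, Category.id_comp]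
    rw [← cancel_epi φ, reassoc_of% h, hm, GrpObj.right_inv_assoc, comp_toUnit_assoc]

variable {A : RealAbelianVariety}

namespace GaloisSubgroup

variable (H : GaloisSubgroup A)

instance : IsFinite (fst A.X specComplex ^ H.exponent : _ ⟶ A.X).left :=
  isFinite_pow H.finite_torsion

/-- The quotient `A / H`, as the quotient of `A ×_ℝ Spec ℂ` by the deck group. -/
def quotient : Over (Spec (.of ℝ)) := Over.mk (H.action.toBase ≫ A.X.hom)

/-- The quotient map from `A ×_ℝ Spec ℂ` to `A / H`. -/
def proj : A.X ⊗ specComplex ⟶ H.quotient :=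
  Over.homMk H.action.proj ((Category.assoc _ _ _).symm.trans
    ((congrArg (· ≫ A.X.hom) H.action.proj_toBase).trans (Over.w _)))

lemma isGaloisCover_proj : IsGaloisCover H.proj.left fun g ↦ (H.deck g).left :=
  H.isFree_action.isGaloisCover

instance : Epi H.proj := H.isGaloisCover_proj.over_epi

lemma deck_proj (g : H.DeckGroup) : H.deck g ≫ H.proj = H.proj :=
  Over.OverMorphism.ext (H.isGaloisCover_proj.comp_eq g)

/-- The Galois group, as a subgroup of the deck group, acts through the factor `Spec ℂ`, so the
quotient map descends from `A ×_ℝ Spec ℂ` to `A`. -/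
lemma exists_fst_comp_eq : ∃ φ : A.X ⟶ H.quotient, fst A.X specComplex ≫ φ = H.proj := by
  refine isGaloisCover_fst.exists_over_desc H.proj fun s ↦ ?_
  have h : H.deck ⟨1, s⟩ = lift (fst _ _) (snd _ _ ≫ specGal s) := by
    rw [deck]
    congr 1
    exact (congrArg (fst _ _ * ·) (MonObj.comp_one _)).trans (mul_one _)
  rw [← h, H.deck_proj]

/-- The quotient map `A ⟶ A / H`. -/
def isogeny : A.X ⟶ H.quotient := H.exists_fst_comp_eq.choose

lemma fst_isogeny : fst A.X specComplex ≫ H.isogeny = H.proj := H.exists_fst_comp_eq.choose_spec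

/-- The quotient map is invariant under translation by the points of `H`. -/
lemma mul_comp_isogeny {T : Over (Spec (.of ℝ))} (a : T ⟶ A.X) (z : T ⟶ specComplex)
    {p : A.ComplexPoint} (hp : p ∈ H.toSubgroup) : (a * z ≫ p) ≫ H.isogeny = a ≫ H.isogeny := by
  have h : lift a z ≫ H.deck ⟨⟨p, hp⟩, 1⟩ ≫ fst _ _ = a * z ≫ p := by
    rw [deck_fst, MonObj.comp_mul, lift_fst, ← Category.assoc, lift_snd]
  rw [← h, Category.assoc, Category.assoc, H.fst_isogeny, H.deck_proj, ← H.fst_isogeny,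
    lift_fst_assoc]

/-- The group law descends to `A / H`, as translations of the summands by points of `H` change the
sum by points of `H`. -/
lemma exists_mul : ∃ m : H.quotient ⊗ H.quotient ⟶ H.quotient,
    (H.isogeny ⊗ₘ H.isogeny) ≫ m = MonObj.mul ≫ H.isogeny := by
  obtain ⟨m, hm⟩ := (H.isGaloisCover_proj.tensorHom H.isGaloisCover_proj).exists_over_desc
    ((fst _ _ ≫ fst A.X specComplex * snd _ _ ≫ fst A.X specComplex) ≫ H.isogeny) fun i ↦ by
      rw [← Category.assoc, MonObj.comp_mul, ← Category.assoc, ← Category.assoc, tensorHom_fst,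
        tensorHom_snd, Category.assoc, Category.assoc, H.deck_fst, H.deck_fst, MonObj.comp_mul,
        MonObj.comp_mul, mul_mul_mul_comm, ← Category.assoc, ← Category.assoc, ← mul_assoc,
        H.mul_comp_isogeny _ _ i.2.left.2, H.mul_comp_isogeny _ _ i.1.left.2]
  have := (isGaloisCover_fst (A := A).tensorHom (isGaloisCover_fst (A := A))).over_epi
  refine ⟨m, ?_⟩
  rw [← cancel_epi (fst A.X specComplex ⊗ₘ fst A.X specComplex), tensorHom_comp_tensorHom_assoc,
    H.fst_isogeny, hm, Hom.mul_def, Category.assoc]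
  congr 1

lemma exists_inv : ∃ i : H.quotient ⟶ H.quotient, H.isogeny ≫ i = GrpObj.inv ≫ H.isogeny := by
  obtain ⟨m, hm⟩ := H.isGaloisCover_proj.exists_over_desc
    ((fst A.X specComplex)⁻¹ ≫ H.isogeny) fun i ↦ by
      rw [← Category.assoc, GrpObj.comp_inv, H.deck_fst, mul_inv, ← GrpObj.comp_inv (snd _ _),
        H.mul_comp_isogeny _ _ (inv_mem i.left.2)]
  refine ⟨m, ?_⟩
  rw [← cancel_epi (fst A.X specComplex), ← Category.assoc, H.fst_isogeny, hm, Hom.inv_def,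
    Category.assoc]

instance : Epi H.isogeny := epi_of_epi_fac H.fst_isogeny

instance : Epi (H.isogeny ⊗ₘ H.isogeny) := by
  have := (H.isGaloisCover_proj.tensorHom H.isGaloisCover_proj).over_epi
  refine epi_of_epi_fac (f := fst A.X specComplex ⊗ₘ fst A.X specComplex)
    (h := H.proj ⊗ₘ H.proj) ?_
  rw [tensorHom_comp_tensorHom, H.fst_isogeny]

instance : Epi ((H.isogeny ⊗ₘ H.isogeny) ⊗ₘ H.isogeny) := by
  have := ((H.isGaloisCover_proj.tensorHom H.isGaloisCover_proj).tensorHom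
    H.isGaloisCover_proj).over_epi
  refine epi_of_epi_fac (f := (fst A.X specComplex ⊗ₘ fst A.X specComplex) ⊗ₘ fst A.X specComplex)
    (h := (H.proj ⊗ₘ H.proj) ⊗ₘ H.proj) ?_
  rw [tensorHom_comp_tensorHom, tensorHom_comp_tensorHom, H.fst_isogeny]

instance : GrpObj H.quotient :=
  .ofEpi H.isogeny H.exists_mul.choose H.exists_mul.choose_spec H.exists_inv.choose
    H.exists_inv.choose_spec

instance : IsMonHom H.isogeny where
  one_hom := rfl
  mul_hom := H.exists_mul.choose_spec.symm

end GaloisSubgroup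

end RealAbelianVariety

end

/-! ### The quotient is an abelian variety; its complex points -/

noncomputable section

namespace RealAbelianVariety.GaloisSubgroup

open Limits MonoidalCategory CartesianMonoidalCategory

variable {A : RealAbelianVariety} (H : GaloisSubgroup A)

instance : IsFinite H.action.toBase := H.action.isFinite_toBase

instance : IsProper H.quotient.hom :=
  inferInstanceAs (IsProper (H.action.toBase ≫ A.X.hom))

instance : Surjective H.proj.left := H.isGaloisCover_proj.surjective

instance : Etale H.proj.left := H.isGaloisCover_proj.etale

instance : IsFinite H.proj.left := by
  have : IsFinite (H.action.proj ≫ H.action.toBase) := by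
    rw [H.action.proj_toBase]
    infer_instance
  exact IsFinite.of_comp H.action.proj H.action.toBase

lemma fst_isogeny_left : (fst A.X specComplex).left ≫ H.isogeny.left = H.proj.left := by
  rw [← Over.comp_left, H.fst_isogeny]

instance surjective_isogeny : Surjective H.isogeny.left := by
  have : Surjective ((fst A.X specComplex).left ≫ H.isogeny.left) := by
    rw [fst_isogeny_left]; infer_instance
  exact Surjective.of_comp (fst A.X specComplex).left _

/-- The quotient map `A ⟶ A / H` is finite, being proper with finite fibres. -/
instance isFinite_isogeny : IsFinite H.isogeny.left := by
  have : IsProper (H.isogeny.left ≫ H.quotient.hom) := by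
    rw [Over.w]; infer_instance
  have : IsProper H.isogeny.left := IsProper.of_comp H.isogeny.left H.quotient.hom
  have : LocallyQuasiFinite H.isogeny.left := by
    refine LocallyQuasiFinite.of_finite_preimage_singleton _ fun y ↦ ?_
    refine ((H.proj.left.finite_preimage_singleton y).image (fst A.X specComplex).left).subset
      fun a ha ↦ ?_
    obtain ⟨x, rfl⟩ := (fst A.X specComplex).left.surjective a
    refine ⟨x, ?_, rfl⟩
    rw [← H.fst_isogeny_left]
    exact ha
  exact IsFinite.of_isProper_of_locallyQuasiFinite _

instance : GeometricallyReduced (A.X ⊗ specComplex).hom := by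
  rw [← Over.w (snd A.X specComplex)]
  have : GeometricallyReduced specComplex.hom := geometricallyReduced_SpecMap_algebraMap ℝ ℂ
  have : LocallyOfFiniteType specComplex.hom := inferInstance
  have : GeometricallyReduced (snd A.X specComplex).left :=
    inferInstanceAs (GeometricallyReduced (pullback.snd A.X.hom specComplex.hom))
  have : Flat A.X.hom := inferInstance
  have : Flat (snd A.X specComplex).left :=
    inferInstanceAs (Flat (pullback.snd A.X.hom specComplex.hom))
  exact GeometricallyReduced.comp_of_flat _ _

end RealAbelianVariety.GaloisSubgroup

namespace AlgebraicGeometry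

universe u
open Limits

lemma GeometricallyReduced.of_flat_of_surjective {X Y S : Scheme.{u}} (f : X ⟶ Y) (g : Y ⟶ S)
    [Flat f] [Surjective f] [GeometricallyReduced (f ≫ g)] : GeometricallyReduced g := by
  refine ⟨fun K _ y W p q h ↦ ?_⟩
  have hp := ((IsPullback.of_hasPullback f p).flip.paste_horiz h.flip).flip
  have := GeometricallyReduced.geometrically_isReduced (f := f ≫ g) y _ _ hp
  exact isReduced_of_flat_of_surjective (pullback.snd f p)

lemma GeometricallyIrreducible.of_surjective {X Y S : Scheme.{u}} (f : X ⟶ Y) (g : Y ⟶ S)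
    [Surjective f] [GeometricallyIrreducible (f ≫ g)] : GeometricallyIrreducible g := by
  refine ⟨fun K _ y W p q h ↦ ?_⟩
  have hp := ((IsPullback.of_hasPullback f p).flip.paste_horiz h.flip).flip
  have : IrreducibleSpace ↑(pullback f p) :=
    GeometricallyIrreducible.geometrically_irreducibleSpace (f := f ≫ g) y _ _ hp
  exact (pullback.snd f p).surjective.irreducibleSpace (pullback.snd f p).continuous

end AlgebraicGeometry

namespace RealAbelianVariety.GaloisSubgroup

open Limits MonoidalCategory CartesianMonoidalCategory

variable {A : RealAbelianVariety} (H : GaloisSubgroup A)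

instance : GeometricallyIntegral H.quotient.hom := by
  have : GeometricallyReduced (H.proj.left ≫ H.quotient.hom) := by
    rw [Over.w]; infer_instance
  have : GeometricallyIrreducible (H.isogeny.left ≫ H.quotient.hom) := by
    rw [Over.w]; infer_instance
  have := GeometricallyReduced.of_flat_of_surjective H.proj.left H.quotient.hom
  have := GeometricallyIrreducible.of_surjective H.isogeny.left H.quotient.hom
  exact .of_geometricallyReduced_of_geometricallyIrreducible _

instance : Smooth H.quotient.hom :=
  have : GrpObj (Over.mk H.quotient.hom) := inferInstanceAs (GrpObj H.quotient)
  smooth_of_grpObj H.quotient.hom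

/-- The quotient of an abelian variety over `ℝ` by a finite Galois-stable group of complex points,
as an abelian variety. -/
def quotientVariety : RealAbelianVariety where
  X := H.quotient

lemma isIsogeny : IsIsogeny (A := A) (B := H.quotientVariety) H.isogeny where
  isMonHom := inferInstanceAs (IsMonHom H.isogeny)
  isFinite := H.isFinite_isogeny
  surjective := H.surjective_isogeny

/-- The kernel of the quotient map on complex points is `H`: points with the same image differ by a
deck transformation. -/
lemma comp_isogeny_eq_iff (p : A.ComplexPoint) :
    p ≫ H.isogeny = (1 : A.ComplexPoint) ≫ H.isogeny ↔ p ∈ H.toSubgroup := by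
  constructor
  · intro h
    obtain ⟨g, hg⟩ := H.isGaloisCover_proj.exists_eq_comp ℂ (lift 1 (𝟙 specComplex)).left
      (lift p (𝟙 specComplex)).left (by
        rw [← Over.comp_left, ← Over.comp_left, ← H.fst_isogeny, lift_fst_assoc, lift_fst_assoc, h])
    have hg' : lift p (𝟙 specComplex) = lift 1 (𝟙 specComplex) ≫ H.deck g :=
      Over.OverMorphism.ext hg
    have := congrArg (· ≫ fst _ _) hg'
    simp only [lift_fst, Category.assoc, deck_fst, MonObj.comp_mul, one_mul, lift_snd_assoc,
      Category.id_comp] at this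
    rw [this]
    exact g.left.2
  · intro hp
    have := H.mul_comp_isogeny 1 (𝟙 specComplex) hp
    rwa [one_mul, Category.id_comp] at this

/-- Every complex point of the quotient lifts, since `ℂ` is algebraically closed. -/
lemma exists_comp_isogeny_eq (b : specComplex ⟶ H.quotient) :
    ∃ p : A.ComplexPoint, p ≫ H.isogeny = b := by
  let P := pullback H.proj.left b.left
  have : IsFinite (pullback.snd H.proj.left b.left) := inferInstance
  have : Surjective (pullback.snd H.proj.left b.left) := inferInstance
  obtain ⟨x, -⟩ := (pullback.snd H.proj.left b.left).surjective (IsLocalRing.closedPoint ℂ)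
  have : JacobsonSpace specComplex.left := inferInstanceAs (JacobsonSpace (Spec (.of ℂ)))
  have : JacobsonSpace P := LocallyOfFiniteType.jacobsonSpace (pullback.snd H.proj.left b.left)
  obtain ⟨y, -, hy⟩ := nonempty_inter_closedPoints (X := P) ⟨x, Set.mem_univ x⟩
    isClosed_univ.isLocallyClosed
  let s := pointOfClosedPoint (K := ℂ) (pullback.snd H.proj.left b.left) y hy
  have hs : s ≫ pullback.snd H.proj.left b.left = 𝟙 _ := pointOfClosedPoint_comp ..
  have hb : (s ≫ pullback.fst H.proj.left b.left) ≫ H.proj.left = b.left := by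
    rw [Category.assoc, pullback.condition, reassoc_of% hs]
  let p : specComplex ⟶ A.X ⊗ specComplex := Over.homMk (s ≫ pullback.fst H.proj.left b.left) (by
    rw [← Over.w H.proj]
    exact (Category.assoc _ _ _).symm.trans ((congrArg (· ≫ _) hb).trans (Over.w b)))
  refine ⟨p ≫ fst _ _, ?_⟩
  rw [Category.assoc, H.fst_isogeny]
  exact Over.OverMorphism.ext hb

end RealAbelianVariety.GaloisSubgroup

end

/-! ### The uniformization of the quotient -/

noncomputable section

namespace RealAbelianVariety

open Limits MonoidalCategory CartesianMonoidalCategory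

variable {A : RealAbelianVariety} (u : Uniformization A)

namespace Uniformization

instance : DiscreteTopology u.lattice := u.discreteTopology_ker

instance : IsZLattice ℝ u.lattice := u.isZLattice_ker

lemma mem_lattice {v : u.V} : v ∈ u.lattice ↔ u.exp v = 0 := Iff.rfl

lemma exp_eq_iff {v w : u.V} : u.exp v = u.exp w ↔ v - w ∈ u.lattice := by
  rw [mem_lattice, map_sub, sub_eq_zero]

lemma exp_nsmul_toMul (n : ℕ) (v : u.V) : (u.exp (n • v)).toMul = (u.exp v).toMul ^ n := by
  rw [map_nsmul, toMul_nsmul]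

/-- The `n`-torsion is `exp (n⁻¹ Λ)`, a finitely generated torsion group. -/
lemma finite_torsion (u : Uniformization A) {n : ℕ} (hn : n ≠ 0) :
    {p : A.ComplexPoint | p ^ n = 1}.Finite := by
  have : Module.Finite ℤ u.lattice := ZLattice.module_finite ℝ u.lattice
  let ψ : u.lattice →+ Additive A.ComplexPoint :=
    { toFun := fun v ↦ u.exp ((n : ℝ)⁻¹ • (v : u.V))
      map_zero' := by simp
      map_add' := fun v w ↦ by rw [Submodule.coe_add, smul_add, map_add] }
  have hψ (v : u.lattice) : n • ψ v = 0 := by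
    change n • u.exp ((n : ℝ)⁻¹ • (v : u.V)) = 0
    rw [← map_nsmul, ← Nat.cast_smul_eq_nsmul ℝ, smul_smul,
      mul_inv_cancel₀ (Nat.cast_ne_zero.2 hn), one_smul]
    exact v.2
  have : AddGroup.FG u.lattice := Module.Finite.iff_addGroup_fg.1 this
  have : Finite ψ.range := by
    refine AddCommGroup.finite_of_fg_isAddTorsion _ ?_
    rintro ⟨_, v, rfl⟩
    exact isOfFinAddOrder_iff_nsmul_eq_zero.2 ⟨n, Nat.pos_of_ne_zero hn, Subtype.ext (hψ v)⟩
  refine (Set.toFinite (ψ.range : Set (Additive A.ComplexPoint))).subset fun p hp ↦ ?_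
  obtain ⟨v, hv⟩ := u.exp_surjective (Additive.ofMul p)
  have hv' : n • v ∈ u.lattice := by
    rw [mem_lattice, map_nsmul, hv]
    exact hp
  refine ⟨⟨n • v, hv'⟩, ?_⟩
  change u.exp ((n : ℝ)⁻¹ • (n • v)) = _
  rw [← Nat.cast_smul_eq_nsmul ℝ, smul_smul, inv_mul_cancel₀ (Nat.cast_ne_zero.2 hn), one_smul, hv]
  rfl

/-- The antilinear lift of complex conjugation, as a real linear map. -/
def realFrob : u.V →ₗ[ℝ] u.V where
  toFun := u.frob
  map_add' := map_add u.frob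
  map_smul' r v := by
    rw [← Complex.coe_smul, map_smulₛₗ, Complex.conj_ofReal]
    rfl

lemma frob_mem_lattice {v : u.V} (hv : v ∈ u.lattice) : u.frob v ∈ u.lattice := by
  have h := u.exp_frob v
  rw [mem_lattice] at hv ⊢
  rw [hv] at h
  exact h.trans (MonObj.comp_one _)

/-- Both `F²` and the identity lift the square of complex conjugation on `A(ℂ)`. -/
lemma frob_frob_sub_mem (v : u.V) : u.frob (u.frob v) - v ∈ u.lattice := by
  rw [← exp_eq_iff]
  have h := u.exp_frob (u.frob v)
  rw [u.exp_frob v] at h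
  refine h.trans ?_
  rw [ComplexPoint.conj, ComplexPoint.conj, ← Category.assoc]
  have : specConj ≫ specConj = 𝟙 _ := by
    have hc : specConj = specGal Complex.conjAe := Over.OverMorphism.ext
      (congrArg (fun f ↦ Spec.map (CommRingCat.ofHom f)) (RingHom.ext fun _ ↦ rfl))
    have hcc : Complex.conjAe * Complex.conjAe = 1 := AlgEquiv.ext fun z ↦ Complex.conj_conj z
    rw [hc, ← specGal_mul, hcc, specGal_one]
  rw [this, Category.id_comp]
  rfl

end Uniformization

/-- The Galois subgroup `exp M` attached to a lattice `M` which is stable under `F_∞` and of finite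
index over the period lattice. -/
def Uniformization.galoisSubgroup (M : Submodule ℤ u.V)
    (hF : ∀ x ∈ M, u.frob x ∈ M) {n : ℕ} (hn : n ≠ 0) (hM : ∀ x ∈ M, n • x ∈ u.lattice) :
    GaloisSubgroup A where
  toSubgroup := AddSubgroup.toSubgroup' (M.toAddSubgroup.map u.exp)
  specGal_comp_mem s p hp := by
    obtain ⟨x, hx, rfl⟩ := hp
    rcases specGal_eq_id_or_conj s with h | h
    · rw [h]
      exact ⟨x, hx, (Category.id_comp (u.exp x).toMul).symm⟩
    · rw [h]
      exact ⟨u.frob x, hF x hx, u.exp_frob x⟩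
  exponent := n
  pow_exponent hp := by
    obtain ⟨x, hx, rfl⟩ := hp
    exact (u.exp_nsmul_toMul n x).symm.trans (hM x hx)
  finite_torsion := u.finite_torsion hn

variable {u} {B : RealAbelianVariety}

/-- Regular functions on `B` pull back along `φ` to regular functions on `A`, also for the junk
value `0` outside of their domain. -/
lemma ComplexPoint.eval_map (φ : A.X ⟶ B.X) (p : A.ComplexPoint) {U : B.X.left.Opens}
    (f : Γ(B.X.left, U)) : (p.map φ).eval f = p.eval (U := φ.left ⁻¹ᵁ U) (φ.left.app U f) := by
  by_cases h : p.MemOpen (φ.left ⁻¹ᵁ U)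
  · have h' : (p.map φ).MemOpen U := h
    rw [eval, eval, dif_pos h, dif_pos h']
    exact congr((Scheme.ΓSpecIso (.of ℂ)).hom.hom
      ($(Scheme.Hom.comp_appLE p.left φ.left U ⊤ h).hom f))
  · have h' : ¬ (p.map φ).MemOpen U := h
    rw [eval, eval, dif_neg h, dif_neg h']

/-- The composition of the exponential map with a homomorphism of abelian varieties. -/
def Uniformization.expMap (u : Uniformization A) (φ : A.X ⟶ B.X) [IsMonHom φ] :
    u.V →+ Additive B.ComplexPoint where
  toFun v := Additive.ofMul ((u.exp v).toMul.map φ)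
  map_zero' := by
    rw [map_zero]
    exact MonObj.one_comp φ
  map_add' v w := by
    rw [map_add]
    exact MonObj.mul_comp _ _ φ

/-- The uniformization of the target of a homomorphism which is surjective on complex points, by the
same vector space. The kernel `M` of the composite map is a parameter, as it is known only up to a
propositional equality. -/
abbrev Uniformization.map (u : Uniformization A) (φ : A.X ⟶ B.X) [IsMonHom φ]
    (hφ : ∀ b : B.ComplexPoint, ∃ p : A.ComplexPoint, p.map φ = b)
    (M : Submodule ℤ u.V) (hM : AddSubgroup.toIntSubmodule (u.expMap φ).ker = M)
    [hd : DiscreteTopology M] (hz : IsZLattice ℝ M) : Uniformization B where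
  V := u.V
  exp := u.expMap φ
  exp_surjective b := by
    obtain ⟨p, hp⟩ := hφ b.toMul
    obtain ⟨v, hv⟩ := u.exp_surjective (Additive.ofMul p)
    refine ⟨v, ?_⟩
    change (u.exp v).toMul.map φ = b.toMul
    rw [hv, ← hp]
    rfl
  isOpen_preimage U := u.isOpen_preimage (φ.left ⁻¹ᵁ U)
  differentiableOn U f := by
    have := u.differentiableOn (φ.left ⁻¹ᵁ U) (φ.left.app U f)
    simp only [← ComplexPoint.eval_map] at this
    exact this
  discreteTopology_ker := by rw [hM]; exact hd
  isZLattice_ker := by simp only [hM]; exact hz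
  frob := u.frob
  exp_frob v := by
    change (u.exp (u.frob v)).toMul ≫ φ = _
    rw [u.exp_frob]
    exact Category.assoc _ _ _

namespace Polarization

variable (P : Polarization u)

lemma isAlt : LinearMap.BilinForm.IsAlt P.E := P.alternating

lemma nondegenerate : LinearMap.BilinForm.Nondegenerate P.E := by
  refine (P.isAlt.isRefl.nondegenerate_iff_separatingLeft).2 fun x hx ↦ ?_
  by_contra h
  have := P.posDef x h
  rw [← P.isAlt.neg_eq, hx] at this
  simp at this

/-- The antilinear lift of complex conjugation is an involution: the endomorphism `F² - 1` is real
linear with values in the lattice, on which the nondegenerate form `E` is integral, so it is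
zero. -/
lemma frob_frob_eq (P : Polarization u) (x : u.V) : u.frob (u.frob x) = x := by
  rw [← sub_eq_zero]
  refine P.nondegenerate.1 _ fun z ↦ ?_
  have h : P.E (u.frob (u.frob x) - x) = 0 := by
    refine ZLattice.eq_zero_of_forall_mem (Λ := u.lattice) _ fun y hy ↦ ?_
    -- `t ↦ E (D (t x), y)` is linear in `t` with integral values
    let D : u.V →ₗ[ℝ] u.V := u.realFrob ∘ₗ u.realFrob - LinearMap.id
    refine ZLattice.eq_zero_of_forall_smul_mem_one ((LinearMap.flip P.E y) ∘ₗ D) x fun t ↦ ?_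
    obtain ⟨n, hn⟩ := P.integral _ y (u.frob_frob_sub_mem (t • x)) hy
    exact Submodule.mem_one.2 ⟨n, hn.symm⟩
  rw [h]
  rfl

lemma isAdmissible : ZLattice.IsAdmissible u.lattice P.E u.realFrob u.lattice where
  le := le_rfl
  map_mem _ hx := u.frob_mem_lattice hx
  le_dual x hx y hy := by
    obtain ⟨n, hn⟩ := P.integral x y hx hy
    exact Submodule.mem_one.2 ⟨n, hn.symm⟩

end Polarization

end RealAbelianVariety

end

theorem theorem4p1 (A : RealAbelianVariety) (u : A.Uniformization)
    (lamA : RealAbelianVariety.Polarization u) :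
    ∃ (B : RealAbelianVariety) (w : B.Uniformization)
      (lamB : RealAbelianVariety.Polarization w) (φ : A.X ⟶ B.X),
      lamB.IsPrincipal ∧ RealAbelianVariety.IsIsogeny φ ∧
        RealAbelianVariety.PullbackEq φ lamB lamA := by
  obtain ⟨M, hd, hz, hM, ⟨n, hn, hnM⟩, huni⟩ := ZLattice.exists_unimodular lamA.isAlt
    lamA.nondegenerate lamA.frob_frob_eq lamA.frob_frob lamA.isAdmissible
  let H := u.galoisSubgroup M hM.map_mem hn hnM
  let B := H.quotientVariety
  let φ : A.X ⟶ B.X := H.isogeny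
  have : IsMonHom φ := H.isIsogeny.isMonHom
  have hker : AddSubgroup.toIntSubmodule (u.expMap φ).ker = M := by
    ext v
    have h := H.comp_isogeny_eq_iff (u.exp v).toMul
    rw [MonObj.one_comp] at h
    refine Iff.trans h ⟨?_, fun hv ↦ ⟨v, hv, rfl⟩⟩
    rintro ⟨x, hx, hxv⟩
    have := hM.le (u.exp_eq_iff.1 hxv)
    simpa using sub_mem hx this
  let w : B.Uniformization := u.map φ H.exists_comp_isogeny_eq M hker hz
  have hw : w.lattice = M := hker
  let lamB : RealAbelianVariety.Polarization w :=
    { E := lamA.E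
      alternating := lamA.alternating
      integral := fun x y hx hy ↦ by
        rw [hw] at hx hy
        obtain ⟨k, hk⟩ := Submodule.mem_one.1 (hM.le_dual hx y hy)
        exact ⟨k, hk.symm⟩
      frob_frob := lamA.frob_frob
      hermitian := lamA.hermitian
      posDef := lamA.posDef }
  refine ⟨B, w, lamB, φ, ?_, H.isIsogeny, LinearMap.id, fun v ↦ rfl, fun x y ↦ rfl⟩
  -- the period lattice of `w` equals `M` only propositionally
  have key (N : Submodule ℤ u.V) (hN : N = M) :
      ∀ l : N →+ ℤ, ∃! x : N, ∀ y : N, lamA.E x y = l y := by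
    subst hN
    exact huni
  exact key _ hw
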